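/- Let $\Bbbk$ be a field and let $H$ be a finite-dimensional Hopf algebra over $\Bbbk$ with comultiplication $\Delta(h)=h_{(1)}\otimes h_{(2)}$, counit $\varepsilon$ and antipode $S$. Let $\hat H$ be the dual Hopf algebra, with product $(\theta\varphi)(h)=\theta(h_{(1)})\varphi(h_{(2)})$ and coproduct determined by $\theta_{(1)}(a)\theta_{(2)}(b)=\theta(ab)$; let $\mathbf p(h,\theta)=\theta(h)$, let $U\in H\otimes\hat H$ be the canonical element ($U=\sum_i h_i\otimes \hat h_i$ for dual bases), with inverse $(S\otimes\mathrm{id})(U)$, let $\mathrm{Ad}(V)(x)=VxV^{-1}$, and let $\Sigma$ be the flip of tensor factors. Algebras are unital and associative over $\Bbbk$, of arbitrary dimension. Coactions on algebras are unital algebra homomorphisms that are coassociative and counital. Morphisms in the categories below are the unital algebra homomorphisms that commute with the given actions and coactions. The Drinfeld codouble $\mathcal T_M(H)=H^{\mathrm{co}}\otimes\hat H$ is the tensor product algebra with counit $\varepsilon\otimes\hat\varepsilon$ and $$\Delta(h\otimes\omega)=(\mathrm{id}\otimes\Sigma\otimes\mathrm{id})(\mathrm{id}\otimes\mathrm{Ad}(U^{-1})\otimes\mathrm{id})(h_{(2)}\otimes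 h_{(1)}\otimes\omega_{(1)}\otimes\omega_{(2)}).$$ The Drinfeld double $\mathcal D_M(H)=\hat H^{\mathrm{op}}\bowtie H$ is the tensor product coalgebra $\hat H\otimes H$, with unit $1\bowtie 1$ and $$(\omega\bowtie h)(\theta\bowtie g)=\big((h_{(2)}\blacktriangleright\theta_{(2)})\,\omega\big)\bowtie\big((h_{(1)}\blacktriangleleft\hat S(\theta_{(1)}))\,g\big),$$ where $h\blacktriangleright\omega=\omega_{(1)}\,\mathbf p(h,\omega_{(2)})$, $h\blacktriangleleft\omega=\mathbf p(h_{(1)},\omega)\,h_{(2)}$, and the products $(\cdot)\,\omega$ and $(\cdot)\,g$ are those of $\hat H$ and $H$. It is paired with $\mathcal T_M(H)$ by $\mathbb P(\omega\bowtie h,g\otimes\theta)=\omega(g)\theta(h)$. Consider the following categories. * $\mathfrak{YD}^{lr}(H,\hat H)$: algebras $X$ with a left coaction $\alpha:X\to H\otimes X$ and a right coaction $\beta:X\to X\otimes\hat H$ such that $(\alpha\otimes\mathrm{id})\beta=\mathrm{Ad}(U_{13})(\mathrm{id}\otimes\beta)\alpha$. * $\mathfrak{Alg}^{\mathcal T_M(H)}$: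 right $\mathcal T_M(H)$-comodule algebras $(X,\gamma)$. * ${}_H^H\mathfrak{YD}$: left $H$-module algebras $(X,\rhd)$ with a left coaction $\alpha:X\to H\otimes X$, $\alpha(x)=x_{[-1]}\otimes x_{[0]}$, such that $h_{(1)}x_{[-1]}\otimes(h_{(2)}\rhd x_{[0]})=(h_{(1)}\rhd x)_{[-1]}h_{(2)}\otimes(h_{(1)}\rhd x)_{[0]}$ for all $h\in H$, $x\in X$. * ${}_{\mathcal D_M(H)}\mathfrak{Alg}$: left $\mathcal D_M(H)$-module algebras. Then the following four assignments, each acting as the identity on underlying algebras and on morphisms, are well-defined functors and are equivalences of categories: 1. $\mathfrak E'_M:\mathfrak{YD}^{lr}(H,\hat H)\to\mathfrak{Alg}^{\mathcal T_M(H)}$, $(X,\alpha,\beta)\mapsto(X,\gamma)$ with $\gamma=(\Sigma\alpha\otimes\mathrm{id})\beta$; 2. $\mathfrak{YD}^{lr}(H,\hat H)\to{}_H^H\mathfrak{YD}$, $(X,\alpha,\beta)\mapsto(X,\rhd_\beta,\alpha)$ with $h\rhd_\beta x=(\mathrm{id}\otimes\mathbf p(h,\cdot))(\beta(x))$; 3.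 $\mathfrak{Alg}^{\mathcal T_M(H)}\to{}_{\mathcal D_M(H)}\mathfrak{Alg}$, $(X,\gamma)\mapsto(X,\rhd_\gamma)$ with $d\rhd_\gamma x=(\mathrm{id}\otimes\mathbb P(d,\cdot))(\gamma(x))$; 4. Majid's functor $\mathfrak E_M:{}_H^H\mathfrak{YD}\to{}_{\mathcal D_M(H)}\mathfrak{Alg}$, $(X,\rhd,\alpha)\mapsto(X,\cdot)$ with $(\omega\bowtie h)\cdot x=(\mathbf p(\cdot,\omega)\otimes\mathrm{id})(\alpha(h\rhd x))$. Moreover the square formed by these functors commutes: the composite of (1) followed by (3) equals the composite of (2) followed by (4). -/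

import Mathlib

open scoped TensorProduct

namespace YetterDrinfeld

noncomputable section

set_option linter.unusedSectionVars false
set_option linter.unusedSimpArgs false

universe u v w

/-- The dual `B̂` of a bialgebra `B`, with the convolution product
`(θ φ)(b) = θ(b₁) φ(b₂)`; for finite-dimensional `B` it is a bialgebra, and a Hopf algebra when
`B` is one. -/
def DualHopf (k : Type u) (B : Type v) [Field k] [Ring B] [Bialgebra k B] : Type (max u v) :=
  WithConv (B →ₗ[k] k)

section Dual
variable (k : Type u) (B : Type v) [Field k] [Ring B] [Bialgebra k B]

instance : Ring (DualHopf k B) := inferInstanceAs (Ring (WithConv (B →ₗ[k] k)))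

instance : Algebra k (DualHopf k B) := inferInstanceAs (Algebra k (WithConv (B →ₗ[k] k)))

/-- The underlying vector space is the dual. -/
def DualHopf.equiv : DualHopf k B ≃ₗ[k] Module.Dual k B where
  toFun θ := WithConv.ofConv θ
  invFun f := WithConv.toConv f
  map_add' _ _ := rfl
  map_smul' _ _ := rfl
  left_inv _ := rfl
  right_inv _ := rfl

instance [FiniteDimensional k B] : FiniteDimensional k (DualHopf k B) :=
  Module.Finite.equiv (DualHopf.equiv k B).symm

/-- The canonical pairing `p(b, θ) = θ(b)`. -/
def pairing : B →ₗ[k] DualHopf k B →ₗ[k] k :=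
  LinearMap.flip (DualHopf.equiv k B).toLinearMap

variable {k B}

theorem DualHopf.ext_pairing {θ φ : DualHopf k B} (h : ∀ b, pairing k B b θ = pairing k B b φ) :
    θ = φ :=
  (DualHopf.equiv k B).injective (LinearMap.ext h)

@[simp] theorem pairing_equiv_symm (b : B) (f : Module.Dual k B) :
    pairing k B b ((DualHopf.equiv k B).symm f) = f b := rfl

theorem equiv_apply (b : B) (θ : DualHopf k B) :
    DualHopf.equiv k B θ b = pairing k B b θ := rfl

@[simp] theorem pairing_one (b : B) : pairing k B b 1 = Coalgebra.counit (R := k) b := rfl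

theorem pairing_mul {ι : Type*} {b : B} (r : Coalgebra.Repr k b ι) (θ φ : DualHopf k B) :
    pairing k B b (θ * φ) =
      ∑ i ∈ r.index, pairing k B (r.left i) θ * pairing k B (r.right i) φ :=
  r.convMul_apply (A := k) θ φ

/-- `m ⊗ θ ↦ p(b, θ) m`. -/
def evalRight (M : Type w) [AddCommMonoid M] [Module k M] (b : B) :
    M ⊗[k] DualHopf k B →ₗ[k] M :=
  (TensorProduct.rid k M).toLinearMap ∘ₗ (pairing k B b).lTensor M

/-- `θ ⊗ m ↦ p(b, θ) m`. -/
def evalLeft (M : Type w) [AddCommMonoid M] [Module k M] (b : B) :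
    DualHopf k B ⊗[k] M →ₗ[k] M :=
  (TensorProduct.lid k M).toLinearMap ∘ₗ (pairing k B b).rTensor M

@[simp] theorem evalRight_tmul {M : Type w} [AddCommMonoid M] [Module k M] (b : B)
    (m : M) (θ : DualHopf k B) : evalRight M b (m ⊗ₜ θ) = pairing k B b θ • m := by
  simp [evalRight]

@[simp] theorem evalLeft_tmul {M : Type w} [AddCommMonoid M] [Module k M] (b : B)
    (m : M) (θ : DualHopf k B) : evalLeft M b (θ ⊗ₜ m) = pairing k B b θ • m := by
  simp [evalLeft]

theorem evalRight_mul {M : Type w} [Ring M] [Algebra k M] {ι : Type*} {b : B}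
    (r : Coalgebra.Repr k b ι) (s t : M ⊗[k] DualHopf k B) :
    evalRight M b (s * t) =
      ∑ i ∈ r.index, evalRight M (r.left i) s * evalRight M (r.right i) t := by
  induction s with
  | zero => simp
  | add x y hx hy => simp only [map_add, add_mul, hx, hy, Finset.sum_add_distrib]
  | tmul m θ =>
    induction t with
    | zero => simp
    | add x y hx hy => simp only [map_add, mul_add, hx, hy, Finset.sum_add_distrib]
    | tmul m' φ =>
      simp [pairing_mul r, Finset.sum_smul, smul_smul, mul_comm]

section Finite
variable [FiniteDimensional k B]

theorem evalLeft_ext {M : Type w} [AddCommMonoid M] [Module k M] {s t : DualHopf k B ⊗[k] M}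
    (h : ∀ b, evalLeft M b s = evalLeft M b t) : s = t := by
  let e : DualHopf k B ⊗[k] M ≃ₗ[k] (B →ₗ[k] M) :=
    (TensorProduct.congr (DualHopf.equiv k B) (LinearEquiv.refl k M)).trans
      (dualTensorHomEquiv k B M)
  have he : ∀ (t : DualHopf k B ⊗[k] M) (b : B), e t b = evalLeft M b t := by
    intro t b
    induction t with
    | zero => simp
    | add x y hx hy => simp only [map_add, LinearMap.add_apply, hx, hy]
    | tmul θ m => simp [e, equiv_apply]
  exact e.injective (LinearMap.ext fun b => by rw [he, he, h])

theorem evalRight_ext {M : Type w} [AddCommMonoid M] [Module k M] {s t : M ⊗[k] DualHopf k B}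
    (h : ∀ b, evalRight M b s = evalRight M b t) : s = t := by
  apply (TensorProduct.comm k _ _).injective
  apply evalLeft_ext
  have key : ∀ (b : B) (t : M ⊗[k] DualHopf k B),
      evalLeft M b (TensorProduct.comm k _ _ t) = evalRight M b t := by
    intro b t
    induction t with
    | zero => simp
    | add x y hx hy => simp only [map_add, hx, hy]
    | tmul m θ => simp
  intro b
  rw [key, key, h]

/-- `⟨Δ θ, a ⊗ b⟩ = θ(ab)`, `ε θ = θ(1)`. -/
instance : CoalgebraStruct k (DualHopf k B) where
  comul :=
    TensorProduct.map (DualHopf.equiv k B).symm.toLinearMap (DualHopf.equiv k B).symm.toLinearMap ∘ₗ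
      (TensorProduct.dualDistribEquiv k B B).symm.toLinearMap ∘ₗ
      (LinearMap.mul' k B).dualMap ∘ₗ (DualHopf.equiv k B).toLinearMap
  counit := pairing k B 1

@[simp] theorem dual_counit (θ : DualHopf k B) :
    Coalgebra.counit (R := k) θ = pairing k B 1 θ := rfl

theorem dual_comul_pairing (θ : DualHopf k B) (a b : B) :
    pairing k B b (evalLeft (DualHopf k B) a (Coalgebra.comul (R := k) θ)) =
      pairing k B (a * b) θ := by
  have key : ∀ t : Module.Dual k B ⊗[k] Module.Dual k B,
      pairing k B b (evalLeft (DualHopf k B) a (TensorProduct.map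
        (DualHopf.equiv k B).symm.toLinearMap (DualHopf.equiv k B).symm.toLinearMap t)) =
        TensorProduct.dualDistribEquiv k B B t (a ⊗ₜ b) := by
    intro t
    induction t with
    | zero => simp
    | add x y hx hy => simp only [map_add, LinearMap.add_apply, hx, hy]
    | tmul θ m => simp [TensorProduct.dualDistribEquiv, TensorProduct.dualDistribEquivOfBasis]
  refine (key _).trans ?_
  simp only [LinearMap.comp_apply, LinearEquiv.coe_coe, LinearEquiv.apply_symm_apply]
  simp [equiv_apply]

theorem pairing_evalRight (t : DualHopf k B ⊗[k] DualHopf k B) (a b : B) :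
    pairing k B b (evalRight (DualHopf k B) a t) = pairing k B a (evalLeft (DualHopf k B) b t) := by
  induction t with
  | zero => simp
  | add x y hx hy => simp only [map_add, hx, hy]
  | tmul θ m => simp [mul_comm]

theorem pairing_evalRight_comul (θ : DualHopf k B) (a b : B) :
    pairing k B b (evalRight (DualHopf k B) a (Coalgebra.comul (R := k) θ)) =
      pairing k B (b * a) θ := by
  rw [pairing_evalRight, dual_comul_pairing]

instance : Coalgebra k (DualHopf k B) where
  coassoc := by
    ext θ : 1
    apply evalLeft_ext; intro a
    apply evalLeft_ext; intro b
    have h1 : ∀ t : DualHopf k B ⊗[k] DualHopf k B,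
      evalLeft _ b (evalLeft _ a (TensorProduct.assoc k _ _ _
        (Coalgebra.comul.rTensor (DualHopf k B) t))) = evalLeft _ (a * b) t := by
      intro t
      induction t with
      | zero => simp
      | add x y hx hy => simp only [map_add, hx, hy]
      | tmul θ φ =>
        have h2 : ∀ s : DualHopf k B ⊗[k] DualHopf k B,
            evalLeft _ b (evalLeft _ a (TensorProduct.assoc k _ _ _ (s ⊗ₜ[k] φ))) =
              pairing k B b (evalLeft _ a s) • φ := by
          intro s
          induction s with
          | zero => simp
          | add x y hx hy => simp only [map_add, TensorProduct.add_tmul, hx, hy, add_smul]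
          | tmul x y => simp [mul_smul]
        simp only [LinearMap.rTensor_tmul, h2, dual_comul_pairing, evalLeft_tmul]
    have h3 : ∀ t : DualHopf k B ⊗[k] DualHopf k B,
      evalLeft _ a (Coalgebra.comul.lTensor (DualHopf k B) t) =
        Coalgebra.comul (R := k) (evalLeft _ a t) := by
      intro t
      induction t with
      | zero => simp
      | add x y hx hy => simp only [map_add, hx, hy]
      | tmul θ φ => simp
    simp only [LinearMap.comp_apply, LinearEquiv.coe_coe, h1, h3]
    apply DualHopf.ext_pairing; intro c
    simp only [dual_comul_pairing, mul_assoc]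
  rTensor_counit_comp_comul := by
    ext θ : 1
    apply (TensorProduct.lid k _).injective
    change evalLeft _ 1 _ = _
    apply DualHopf.ext_pairing; intro c
    simp [dual_comul_pairing]
  lTensor_counit_comp_comul := by
    ext θ : 1
    apply (TensorProduct.rid k _).injective
    change evalRight _ 1 _ = _
    apply DualHopf.ext_pairing; intro c
    simp [pairing_evalRight_comul]

theorem comul_repr_mul {ι κ : Type*} {a b : B} (r : Coalgebra.Repr k a ι)
    (s : Coalgebra.Repr k b κ) : Coalgebra.comul (R := k) (a * b) =
      ∑ x ∈ r.index ×ˢ s.index, (r.left x.1 * s.left x.2) ⊗ₜ[k] (r.right x.1 * s.right x.2) := by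
  rw [Bialgebra.comul_mul, ← r.eq, ← s.eq, Finset.sum_mul_sum, Finset.sum_product]
  simp

instance : Bialgebra k (DualHopf k B) := by
  refine Bialgebra.mk' k (DualHopf k B) ?_ ?_ ?_ ?_
  · simp
  · intro θ φ
    simp only [dual_counit]
    let r : Coalgebra.Repr k (1 : B) Unit :=
      ⟨{()}, fun _ => 1, fun _ => 1, by simp [Algebra.TensorProduct.one_def]⟩
    rw [pairing_mul r]
    simp [r]
  · apply evalRight_ext
    intro b
    apply DualHopf.ext_pairing; intro a
    rw [pairing_evalRight_comul, Algebra.TensorProduct.one_def, evalRight_tmul]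
    simp [mul_comm]
  · intro θ φ
    apply evalRight_ext; intro b
    apply DualHopf.ext_pairing; intro a
    rw [evalRight_mul (Coalgebra.Repr.arbitrary k b), pairing_evalRight_comul]
    simp only [map_sum, pairing_mul (Coalgebra.Repr.arbitrary k a), pairing_evalRight_comul]
    rw [pairing_mul ⟨_, _, _, (comul_repr_mul (Coalgebra.Repr.arbitrary k a)
      (Coalgebra.Repr.arbitrary k b)).symm⟩, Finset.sum_product_right]

end Finite
end Dual

section
variable (k : Type u) (H : Type v) [Field k] [Ring H] [HopfAlgebra k H] [FiniteDimensional k H]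

/-- The antipode of the dual is the transpose. -/
instance : HopfAlgebra k (DualHopf k H) where
  antipode := (DualHopf.equiv k H).symm.toLinearMap ∘ₗ
    (HopfAlgebra.antipode k (A := H)).dualMap ∘ₗ (DualHopf.equiv k H).toLinearMap
  mul_antipode_rTensor_comul := by
    ext θ : 1
    apply DualHopf.ext_pairing; intro h
    let r := Coalgebra.Repr.arbitrary k h
    have key : ∀ t : DualHopf k H ⊗[k] DualHopf k H,
        pairing k H h (LinearMap.mul' k _ (((DualHopf.equiv k H).symm.toLinearMap ∘ₗ
          (HopfAlgebra.antipode k (A := H)).dualMap ∘ₗ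
          (DualHopf.equiv k H).toLinearMap).rTensor _ t)) = ∑ i ∈ r.index,
          pairing k H (r.right i) (evalLeft _ (HopfAlgebra.antipode k (r.left i)) t) := by
      intro t
      induction t with
      | zero => simp
      | add x y hx hy => simp only [map_add, hx, hy, Finset.sum_add_distrib]
      | tmul θ φ => simp [pairing_mul r, equiv_apply]
    simp only [LinearMap.comp_apply, key, dual_comul_pairing]
    rw [← LinearMap.sum_apply, ← map_sum, HopfAlgebra.sum_antipode_mul_eq_algebraMap_counit r]
    simp [Algebra.algebraMap_eq_smul_one, mul_comm]
  mul_antipode_lTensor_comul := by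
    ext θ : 1
    apply DualHopf.ext_pairing; intro h
    let r := Coalgebra.Repr.arbitrary k h
    have key : ∀ t : DualHopf k H ⊗[k] DualHopf k H,
        pairing k H h (LinearMap.mul' k _ (((DualHopf.equiv k H).symm.toLinearMap ∘ₗ
          (HopfAlgebra.antipode k (A := H)).dualMap ∘ₗ
          (DualHopf.equiv k H).toLinearMap).lTensor _ t)) = ∑ i ∈ r.index,
          pairing k H (HopfAlgebra.antipode k (r.right i)) (evalLeft _ (r.left i) t) := by
      intro t
      induction t with
      | zero => simp
      | add x y hx hy => simp only [map_add, hx, hy, Finset.sum_add_distrib]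
      | tmul θ φ => simp [pairing_mul r, equiv_apply]
    simp only [LinearMap.comp_apply, key, dual_comul_pairing]
    rw [← LinearMap.sum_apply, ← map_sum, HopfAlgebra.sum_mul_antipode_eq_algebraMap_counit r]
    simp [Algebra.algebraMap_eq_smul_one, mul_comm]
end

section Canonical
variable (k : Type u) (H : Type v) [Field k] [Ring H] [HopfAlgebra k H] [FiniteDimensional k H]

/-- The canonical element `U = ∑ hᵢ ⊗ ĥᵢ`, for a basis `hᵢ` of `H` with dual basis `ĥᵢ`. -/
def canonicalElement : H ⊗[k] DualHopf k H :=
  (DualHopf.equiv k H).symm.toLinearMap.lTensor H (coevaluation k H 1)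

variable {k H}

theorem evalRight_map {M N : Type*} [AddCommMonoid M] [Module k M] [AddCommMonoid N] [Module k N]
    (f : M →ₗ[k] N) (h : H) (t : M ⊗[k] DualHopf k H) :
    evalRight N h (f.rTensor _ t) = f (evalRight M h t) := by
  induction t with
  | zero => simp
  | add x y hx hy => simp only [map_add, hx, hy]
  | tmul m θ => simp

theorem evalRight_map' {M N : Type*} [Ring M] [Algebra k M] [Ring N] [Algebra k N]
    (f : M →ₐ[k] N) (h : H) (t : M ⊗[k] DualHopf k H) :
    evalRight N h (Algebra.TensorProduct.map f (AlgHom.id k _) t) = f (evalRight M h t) :=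
  evalRight_map f.toLinearMap h t

theorem evalRight_one {M : Type*} [Ring M] [Algebra k M] (h : H) :
    evalRight M h (1 : M ⊗[k] DualHopf k H) = Coalgebra.counit (R := k) h • 1 := by
  rw [Algebra.TensorProduct.one_def, evalRight_tmul, pairing_one]

theorem evalRight_canonicalElement (h : H) : evalRight H h (canonicalElement k H) = h := by
  simp only [canonicalElement, coevaluation_apply_one, map_sum, LinearMap.lTensor_tmul,
    evalRight_tmul]
  exact (Module.Basis.ofVectorSpace k H).sum_repr h

variable (k H)

/-- The canonical element as a unit, with inverse `(S ⊗ id)(U)`. -/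
def canonicalUnit : (H ⊗[k] DualHopf k H)ˣ where
  val := canonicalElement k H
  inv := (HopfAlgebra.antipode k).rTensor (DualHopf k H) (canonicalElement k H)
  val_inv := by
    apply evalRight_ext; intro h
    rw [evalRight_mul (Coalgebra.Repr.arbitrary k h), evalRight_one]
    simp only [evalRight_map, evalRight_canonicalElement]
    exact HopfAlgebra.sum_mul_antipode_eq_smul (Coalgebra.Repr.arbitrary k h)
  inv_val := by
    apply evalRight_ext; intro h
    rw [evalRight_mul (Coalgebra.Repr.arbitrary k h), evalRight_one]
    simp only [evalRight_map, evalRight_canonicalElement]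
    exact HopfAlgebra.sum_antipode_mul_eq_smul (Coalgebra.Repr.arbitrary k h)

variable {k H}

theorem comul_canonicalElement :
    Algebra.TensorProduct.map (Bialgebra.comulAlgHom k H) (AlgHom.id k (DualHopf k H))
        (canonicalElement k H) =
      Algebra.TensorProduct.map (Algebra.TensorProduct.includeLeft : H →ₐ[k] H ⊗[k] H)
          (AlgHom.id k (DualHopf k H)) (canonicalElement k H) *
        Algebra.TensorProduct.map (Algebra.TensorProduct.includeRight : H →ₐ[k] H ⊗[k] H)
          (AlgHom.id k (DualHopf k H)) (canonicalElement k H) := by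
  apply evalRight_ext; intro h
  rw [evalRight_mul (Coalgebra.Repr.arbitrary k h)]
  simp only [evalRight_map', evalRight_canonicalElement]
  simp [(Coalgebra.Repr.arbitrary k h).eq]

theorem canonicalElement_comul :
    Algebra.TensorProduct.map (AlgHom.id k H) (Bialgebra.comulAlgHom k (DualHopf k H))
        (canonicalElement k H) =
      Algebra.TensorProduct.map (AlgHom.id k H) Algebra.TensorProduct.includeLeft
          (canonicalElement k H) *
        Algebra.TensorProduct.map (AlgHom.id k H) Algebra.TensorProduct.includeRight
          (canonicalElement k H) := by
  apply (Algebra.TensorProduct.assoc k k k H (DualHopf k H) (DualHopf k H)).symm.injective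
  apply evalRight_ext; intro b
  rw [map_mul, evalRight_mul (Coalgebra.Repr.arbitrary k b)]
  have h1 : ∀ (c : H) (t : H ⊗[k] DualHopf k H), evalRight _ c
      ((Algebra.TensorProduct.assoc k k k H (DualHopf k H) (DualHopf k H)).symm
        (Algebra.TensorProduct.map (AlgHom.id k H) Algebra.TensorProduct.includeLeft t)) =
      Coalgebra.counit (R := k) c • t := by
    intro c t
    induction t with
    | zero => simp
    | add x y hx hy => simp only [map_add, hx, hy, smul_add]
    | tmul m θ => simp
  have h2 : ∀ (c : H) (t : H ⊗[k] DualHopf k H), evalRight _ c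
      ((Algebra.TensorProduct.assoc k k k H (DualHopf k H) (DualHopf k H)).symm
        (Algebra.TensorProduct.map (AlgHom.id k H) Algebra.TensorProduct.includeRight t)) =
      evalRight _ c t ⊗ₜ 1 := by
    intro c t
    induction t with
    | zero => simp
    | add x y hx hy => simp only [map_add, hx, hy, TensorProduct.add_tmul]
    | tmul m θ => simp [TensorProduct.smul_tmul']
  have h3 : ∀ (a : H) (t : H ⊗[k] DualHopf k H), evalRight _ a (evalRight _ b
      ((Algebra.TensorProduct.assoc k k k H (DualHopf k H) (DualHopf k H)).symm
        (Algebra.TensorProduct.map (AlgHom.id k H) (Bialgebra.comulAlgHom k (DualHopf k H)) t))) =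
      evalRight _ (a * b) t := by
    intro a t
    induction t with
    | zero => simp
    | add x y hx hy => simp only [map_add, hx, hy]
    | tmul m θ =>
      rw [evalRight_tmul, ← pairing_evalRight_comul]
      simp only [Algebra.TensorProduct.map_tmul, Bialgebra.comulAlgHom_apply, AlgHom.coe_id, id_eq]
      induction Coalgebra.comul (R := k) θ with
      | zero => simp
      | add x y hx hy => simp only [map_add, TensorProduct.tmul_add, hx, hy, add_smul]
      | tmul x y => simp [smul_smul]
  apply evalRight_ext; intro a
  rw [h3, evalRight_canonicalElement]
  simp only [h1, h2, evalRight_canonicalElement, smul_mul_assoc, ← mul_smul_comm]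
  rw [← Finset.mul_sum]
  have h4 := Coalgebra.sum_counit_smul (Coalgebra.Repr.arbitrary k b)
  simp only [TensorProduct.smul_tmul', ← TensorProduct.sum_tmul, h4]
  rw [evalRight_mul (Coalgebra.Repr.arbitrary k a)]
  simp only [evalRight_canonicalElement, evalRight_tmul, pairing_one]
  simp only [mul_smul_comm, ← smul_mul_assoc, ← Finset.sum_mul]
  have h5 := congr(TensorProduct.rid k H
    $(Coalgebra.sum_tmul_counit_eq (Coalgebra.Repr.arbitrary k a)))
  simp only [map_sum, TensorProduct.rid_tmul, one_smul] at h5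
  rw [h5]

theorem counit_canonicalElement :
    Algebra.TensorProduct.map (Bialgebra.counitAlgHom k H) (AlgHom.id k (DualHopf k H))
        (canonicalElement k H) = 1 := by
  apply evalRight_ext; intro h
  rw [evalRight_map', evalRight_canonicalElement, evalRight_one]
  simp

theorem canonicalElement_counit :
    Algebra.TensorProduct.map (AlgHom.id k H) (Bialgebra.counitAlgHom k (DualHopf k H))
        (canonicalElement k H) = 1 := by
  apply (TensorProduct.rid k H).injective
  change evalRight H 1 _ = _
  rw [evalRight_canonicalElement]
  simp [Algebra.TensorProduct.one_def]
end Canonical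

/-- `Ad(u)(x) = u x u⁻¹`. -/
def Ad {k : Type*} {A : Type*} [CommRing k] [Ring A] [Algebra k A] (u : Aˣ) : A →ₐ[k] A :=
  AlgHom.ofLinearMap (LinearMap.mulLeft k (u : A) ∘ₗ LinearMap.mulRight k (↑u⁻¹ : A))
    (by simp) (fun x y => by simp [mul_assoc])

theorem Ad_apply {k : Type*} {A : Type*} [CommRing k] [Ring A] [Algebra k A] (u : Aˣ) (x : A) :
    Ad (k := k) u x = u * x * ↑u⁻¹ := by
  simp [Ad, mul_assoc]

theorem twist_coassoc {k : Type*} {A : Type*} [CommRing k] [Ring A] [Algebra k A]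
    (D : A →ₐ[k] A ⊗[k] A) (V : (A ⊗[k] A)ˣ)
    (hD : (Algebra.TensorProduct.assoc k k k A A A).toAlgHom.comp
      ((Algebra.TensorProduct.map D (.id k A)).comp D) =
        (Algebra.TensorProduct.map (.id k A) D).comp D)
    (hV : Algebra.TensorProduct.assoc k k k A A A ((V : A ⊗[k] A) ⊗ₜ 1) *
        Algebra.TensorProduct.assoc k k k A A A (Algebra.TensorProduct.map D (.id k A) V) =
      (1 ⊗ₜ (V : A ⊗[k] A)) * Algebra.TensorProduct.map (.id k A) D V) :
    (Algebra.TensorProduct.assoc k k k A A A).toAlgHom.comp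
      ((Algebra.TensorProduct.map ((Ad V).comp D) (.id k A)).comp ((Ad V).comp D)) =
        (Algebra.TensorProduct.map (.id k A) ((Ad V).comp D)).comp ((Ad V).comp D) := by
  let u1 : (A ⊗[k] (A ⊗[k] A))ˣ :=
    Units.map (((Algebra.TensorProduct.assoc k k k A A A).toAlgHom.comp
      Algebra.TensorProduct.includeLeft : A ⊗[k] A →ₐ[k] _) : A ⊗[k] A →* _) V
  let u2 : (A ⊗[k] (A ⊗[k] A))ˣ :=
    Units.map ((Algebra.TensorProduct.includeRight : A ⊗[k] A →ₐ[k] A ⊗[k] (A ⊗[k] A)) :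
      A ⊗[k] A →* A ⊗[k] (A ⊗[k] A)) V
  let g1 : A ⊗[k] A →ₐ[k] A ⊗[k] (A ⊗[k] A) :=
    (Algebra.TensorProduct.assoc k k k A A A).toAlgHom.comp (Algebra.TensorProduct.map D (.id k A))
  let g2 : A ⊗[k] A →ₐ[k] A ⊗[k] (A ⊗[k] A) := Algebra.TensorProduct.map (.id k A) D
  have e1 : (Algebra.TensorProduct.assoc k k k A A A).toAlgHom.comp
      (Algebra.TensorProduct.map ((Ad V).comp D) (.id k A)) = (Ad u1).comp g1 := by
    have : Algebra.TensorProduct.map ((Ad V).comp D) (.id k A) =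
        (Algebra.TensorProduct.map (Ad V) (.id k A)).comp
          (Algebra.TensorProduct.map D (.id k A)) := by
      ext <;> simp
    rw [this]
    ext t
    all_goals
      simp only [g1, AlgHom.comp_apply, Ad_apply]
      simp [u1, Ad_apply, Algebra.TensorProduct.one_def]
    · rw [← map_mul, ← map_mul]; simp
    · rw [← Algebra.TensorProduct.assoc_tmul (R := k) (S := k) (T := k), ← map_mul, ← map_mul]
      simp
  have e2 : (Algebra.TensorProduct.map (.id k A) ((Ad V).comp D)) = (Ad u2).comp g2 := by
    ext t
    all_goals
      simp only [g2, AlgHom.comp_apply, Ad_apply]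
      simp [u2, Ad_apply, Algebra.TensorProduct.one_def]
  have hu : u1 * Units.map (g1 : A ⊗[k] A →* _) V = u2 * Units.map (g2 : A ⊗[k] A →* _) V :=
    Units.ext hV
  ext t
  have hD' : g1 (D t) = g2 (D t) := congr($hD t)
  have l1 : ∀ (u : (A ⊗[k] (A ⊗[k] A))ˣ) (g : A ⊗[k] A →ₐ[k] A ⊗[k] (A ⊗[k] A)),
      Ad (k := k) u (g (Ad (k := k) V (D t))) =
        Ad (k := k) (u * Units.map (g : A ⊗[k] A →* _) V) (g (D t)) := by
    intro u g
    simp [Ad_apply, mul_assoc]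
  have := l1 u1 g1
  rw [hu, hD', ← l1 u2 g2] at this
  calc _ = Ad (k := k) u1 (g1 (Ad (k := k) V (D t))) := congr($e1 (Ad (k := k) V (D t)))
    _ = _ := this
    _ = _ := (congr($e2 (Ad (k := k) V (D t)))).symm

section Codouble
variable (k : Type u) (H : Type v) [Field k] [Ring H] [HopfAlgebra k H] [FiniteDimensional k H]

/-- `h ⊗ ω ↦ (h₂ ⊗ h₁) ⊗ (ω₁ ⊗ ω₂)`: the comultiplications of `H^co` and of the dual. -/
def splitAlgHom : H ⊗[k] DualHopf k H →ₐ[k]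
    (H ⊗[k] H) ⊗[k] (DualHopf k H ⊗[k] DualHopf k H) :=
  Algebra.TensorProduct.map
    ((Algebra.TensorProduct.comm k H H).toAlgHom.comp (Bialgebra.comulAlgHom k H))
    (Bialgebra.comulAlgHom k (DualHopf k H))

/-- `x ⊗ θ ↦ (1 ⊗ x) ⊗ (θ ⊗ 1)`. -/
def middleAlgHom : H ⊗[k] DualHopf k H →ₐ[k]
    (H ⊗[k] H) ⊗[k] (DualHopf k H ⊗[k] DualHopf k H) :=
  Algebra.TensorProduct.map Algebra.TensorProduct.includeRight
    Algebra.TensorProduct.includeLeft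

/-- `(a ⊗ b) ⊗ (θ ⊗ φ) ↦ (a ⊗ θ) ⊗ (b ⊗ φ)`. -/
def shuffleAlgHom : (H ⊗[k] H) ⊗[k] (DualHopf k H ⊗[k] DualHopf k H) →ₐ[k]
    (H ⊗[k] DualHopf k H) ⊗[k] (H ⊗[k] DualHopf k H) :=
  (Algebra.TensorProduct.tensorTensorTensorComm k k k k H H (DualHopf k H)
    (DualHopf k H)).toAlgHom

/-- `h ⊗ ω ↦ (id ⊗ Σ ⊗ id) (id ⊗ Ad(U⁻¹) ⊗ id) (h₂ ⊗ h₁ ⊗ ω₁ ⊗ ω₂)`. The intermediate element is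
stored as `(h₂ ⊗ h₁) ⊗ (ω₁ ⊗ ω₂)`, and the two middle legs are conjugated by `U⁻¹`. -/
def codoubleComul : H ⊗[k] DualHopf k H →ₐ[k]
    (H ⊗[k] DualHopf k H) ⊗[k] (H ⊗[k] DualHopf k H) :=
  (shuffleAlgHom k H).comp
    ((Ad (Units.map (middleAlgHom k H : _ →* _) (canonicalUnit k H)⁻¹)).comp (splitAlgHom k H))

/-- `ε ⊗ ε̂`. -/
def codoubleCounit : H ⊗[k] DualHopf k H →ₐ[k] k :=
  (Algebra.TensorProduct.lid k k).toAlgHom.comp (Algebra.TensorProduct.map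
    (Bialgebra.counitAlgHom k H) (Bialgebra.counitAlgHom k (DualHopf k H)))

variable {k H}

/-- The twisting unit. -/
def twistUnit : ((H ⊗[k] DualHopf k H) ⊗[k] (H ⊗[k] DualHopf k H))ˣ :=
  Units.map (((shuffleAlgHom k H).comp (middleAlgHom k H) : _ →ₐ[k] _) : _ →* _)
    (canonicalUnit k H)⁻¹

theorem codoubleComul_eq :
    codoubleComul k H = (Ad twistUnit).comp ((shuffleAlgHom k H).comp (splitAlgHom k H)) := by
  apply AlgHom.ext; intro t
  simp [codoubleComul, twistUnit, Ad_apply]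

/-- `h ↦ h ⊗ 1`. -/
abbrev inL : H →ₐ[k] H ⊗[k] DualHopf k H := Algebra.TensorProduct.includeLeft
/-- `ω ↦ 1 ⊗ ω`. -/
abbrev inR : DualHopf k H →ₐ[k] H ⊗[k] DualHopf k H := Algebra.TensorProduct.includeRight

theorem split_left (h : H) : shuffleAlgHom k H (splitAlgHom k H (h ⊗ₜ 1)) =
    Algebra.TensorProduct.map inL inL (TensorProduct.comm k H H (Coalgebra.comul (R := k) h)) := by
  simp only [splitAlgHom, Algebra.TensorProduct.map_tmul, AlgHom.comp_apply, map_one,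
    Bialgebra.comulAlgHom_apply]
  induction Coalgebra.comul (R := k) h with
  | zero => simp
  | add x y hx hy => simp only [map_add, TensorProduct.add_tmul, hx, hy]
  | tmul x y => simp [shuffleAlgHom, Algebra.TensorProduct.one_def]

theorem split_right (θ : DualHopf k H) : shuffleAlgHom k H (splitAlgHom k H (1 ⊗ₜ θ)) =
    Algebra.TensorProduct.map inR inR (Coalgebra.comul (R := k) θ) := by
  simp only [splitAlgHom, Algebra.TensorProduct.map_tmul, map_one,
    Bialgebra.comulAlgHom_apply]
  induction Coalgebra.comul (R := k) θ with
  | zero => simp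
  | add x y hx hy => simp only [map_add, TensorProduct.tmul_add, hx, hy]
  | tmul x y => simp [shuffleAlgHom, Algebra.TensorProduct.one_def]

theorem split_coassoc :
    (Algebra.TensorProduct.assoc k k k _ _ _).toAlgHom.comp
      ((Algebra.TensorProduct.map ((shuffleAlgHom k H).comp (splitAlgHom k H)) (.id k _)).comp
        ((shuffleAlgHom k H).comp (splitAlgHom k H))) =
        (Algebra.TensorProduct.map (.id k _) ((shuffleAlgHom k H).comp (splitAlgHom k H))).comp
          ((shuffleAlgHom k H).comp (splitAlgHom k H)) := by
  apply Algebra.TensorProduct.ext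
  · apply AlgHom.ext; intro h
    let J : H ⊗[k] (H ⊗[k] H) →ₗ[k] (H ⊗[k] DualHopf k H) ⊗[k] ((H ⊗[k] DualHopf k H) ⊗[k]
        (H ⊗[k] DualHopf k H)) :=
      (TensorProduct.assoc k _ _ _).toLinearMap ∘ₗ
      (TensorProduct.map (TensorProduct.map inL.toLinearMap inL.toLinearMap) inL.toLinearMap) ∘ₗ
      (TensorProduct.comm k _ _).toLinearMap ∘ₗ
      (TensorProduct.map LinearMap.id (TensorProduct.comm k H H).toLinearMap)
    have h1 : ∀ t : H ⊗[k] H, (Algebra.TensorProduct.assoc k k k _ _ _)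
        (Algebra.TensorProduct.map ((shuffleAlgHom k H).comp (splitAlgHom k H)) (.id k _)
          (Algebra.TensorProduct.map inL inL (TensorProduct.comm k H H t))) =
        J (Coalgebra.comul.lTensor H t) := by
      intro t
      induction t with
      | zero => simp
      | add x y hx hy => simp only [map_add, hx, hy]
      | tmul x y =>
        simp only [TensorProduct.comm_tmul, Algebra.TensorProduct.map_tmul, AlgHom.comp_apply,
          Algebra.TensorProduct.includeLeft_apply, split_left, LinearMap.lTensor_tmul,
          AlgHom.coe_id, id_eq]
        induction Coalgebra.comul (R := k) y with
        | zero => simp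
        | add x y hx hy => simp only [map_add, TensorProduct.add_tmul, TensorProduct.tmul_add, hx, hy]
        | tmul x y => simp [J]
    have h2 : ∀ t : H ⊗[k] H,
        (Algebra.TensorProduct.map (.id k _) ((shuffleAlgHom k H).comp (splitAlgHom k H))
          (Algebra.TensorProduct.map inL inL (TensorProduct.comm k H H t))) =
        J (TensorProduct.assoc k _ _ _ (Coalgebra.comul.rTensor H t)) := by
      intro t
      induction t with
      | zero => simp
      | add x y hx hy => simp only [map_add, hx, hy]
      | tmul x y =>
        simp only [TensorProduct.comm_tmul, Algebra.TensorProduct.map_tmul, AlgHom.comp_apply,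
          Algebra.TensorProduct.includeLeft_apply, split_left, LinearMap.rTensor_tmul,
          AlgHom.coe_id, id_eq]
        induction Coalgebra.comul (R := k) x with
        | zero => simp
        | add x y hx hy => simp only [map_add, TensorProduct.add_tmul, TensorProduct.tmul_add, hx, hy]
        | tmul x y => simp [J]
    refine (congrArg (fun t => (Algebra.TensorProduct.assoc k k k _ _ _)
        (Algebra.TensorProduct.map ((shuffleAlgHom k H).comp (splitAlgHom k H)) (.id k _) t))
        (split_left h)).trans ?_
    refine Eq.trans ?_ (congrArg (fun t =>
        (Algebra.TensorProduct.map (.id k _) ((shuffleAlgHom k H).comp (splitAlgHom k H)) t))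
        (split_left h)).symm
    simp only [h1, h2, Coalgebra.coassoc_apply]
  · apply AlgHom.ext; intro θ
    let J : DualHopf k H ⊗[k] (DualHopf k H ⊗[k] DualHopf k H) →ₗ[k]
        (H ⊗[k] DualHopf k H) ⊗[k] ((H ⊗[k] DualHopf k H) ⊗[k] (H ⊗[k] DualHopf k H)) :=
      TensorProduct.map inR.toLinearMap (TensorProduct.map inR.toLinearMap inR.toLinearMap)
    have h1 : ∀ t : DualHopf k H ⊗[k] DualHopf k H, (Algebra.TensorProduct.assoc k k k _ _ _)
        (Algebra.TensorProduct.map ((shuffleAlgHom k H).comp (splitAlgHom k H)) (.id k _)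
          (Algebra.TensorProduct.map inR inR t)) =
        J (TensorProduct.assoc k _ _ _ (Coalgebra.comul.rTensor _ t)) := by
      intro t
      induction t with
      | zero => simp
      | add x y hx hy => simp only [map_add, hx, hy]
      | tmul x y =>
        simp only [Algebra.TensorProduct.map_tmul, AlgHom.comp_apply,
          Algebra.TensorProduct.includeRight_apply, split_right, LinearMap.rTensor_tmul,
          AlgHom.coe_id, id_eq]
        induction Coalgebra.comul (R := k) x with
        | zero => simp
        | add x y hx hy => simp only [map_add, TensorProduct.add_tmul, TensorProduct.tmul_add, hx, hy]
        | tmul x y => simp [J]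
    have h2 : ∀ t : DualHopf k H ⊗[k] DualHopf k H,
        (Algebra.TensorProduct.map (.id k _) ((shuffleAlgHom k H).comp (splitAlgHom k H))
          (Algebra.TensorProduct.map inR inR t)) =
        J (Coalgebra.comul.lTensor _ t) := by
      intro t
      induction t with
      | zero => simp
      | add x y hx hy => simp only [map_add, hx, hy]
      | tmul x y =>
        simp only [Algebra.TensorProduct.map_tmul, AlgHom.comp_apply,
          Algebra.TensorProduct.includeRight_apply, split_right, LinearMap.lTensor_tmul,
          AlgHom.coe_id, id_eq]
        induction Coalgebra.comul (R := k) y with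
        | zero => simp
        | add x y hx hy => simp only [map_add, TensorProduct.add_tmul, TensorProduct.tmul_add, hx, hy]
        | tmul x y => simp [J]
    refine (congrArg (fun t => (Algebra.TensorProduct.assoc k k k _ _ _)
        (Algebra.TensorProduct.map ((shuffleAlgHom k H).comp (splitAlgHom k H)) (.id k _) t))
        (split_right θ)).trans ?_
    refine Eq.trans ?_ (congrArg (fun t =>
        (Algebra.TensorProduct.map (.id k _) ((shuffleAlgHom k H).comp (splitAlgHom k H)) t))
        (split_right θ)).symm
    simp only [h1, h2, Coalgebra.coassoc_apply]

end Codouble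

section Codouble
variable (k : Type u) (H : Type v) [Field k] [Ring H] [HopfAlgebra k H] [FiniteDimensional k H]
variable {k H}

theorem tmul_one_left {M : Type w} [AddCommMonoid M] [Module k M] (c : k) (t : M) :
    c ⊗ₜ[k] t = 1 ⊗ₜ[k] (c • t) := by
  rw [← TensorProduct.smul_tmul, smul_eq_mul, mul_one]

theorem tmul_one_right {M : Type w} [AddCommMonoid M] [Module k M] (c : k) (t : M) :
    t ⊗ₜ[k] c = (c • t) ⊗ₜ[k] 1 := by
  rw [TensorProduct.smul_tmul, smul_eq_mul, mul_one]

theorem commute_of_tmul {T : Type w} [Semiring T] [Algebra k T] (P Q : H ⊗[k] DualHopf k H →ₐ[k] T)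
    (h : ∀ x θ y φ, P (x ⊗ₜ θ) * Q (y ⊗ₜ φ) = Q (y ⊗ₜ φ) * P (x ⊗ₜ θ))
    (s t : H ⊗[k] DualHopf k H) : P s * Q t = Q t * P s := by
  induction s with
  | zero => simp
  | add x y hx hy => simp only [map_add, add_mul, mul_add, hx, hy]
  | tmul x θ =>
    induction t with
    | zero => simp
    | add x y hx hy => simp only [map_add, add_mul, mul_add, hx, hy]
    | tmul y φ => exact h x θ y φ

theorem mul_swap_right {T : Type w} [Semiring T] (a b c : T) (h : b * c = c * b) :
    a * c * b = a * b * c := by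
  rw [mul_assoc, ← h, mul_assoc]

theorem twist_cocycle :
    Algebra.TensorProduct.assoc k k k _ _ _
        ((twistUnit : ((H ⊗[k] DualHopf k H) ⊗[k] (H ⊗[k] DualHopf k H))ˣ).val ⊗ₜ 1) *
      Algebra.TensorProduct.assoc k k k _ _ _ (Algebra.TensorProduct.map
        ((shuffleAlgHom k H).comp (splitAlgHom k H)) (.id k _) twistUnit.val) =
      (1 ⊗ₜ twistUnit.val) * Algebra.TensorProduct.map (.id k _)
        ((shuffleAlgHom k H).comp (splitAlgHom k H)) twistUnit.val := by
  let sm : (H ⊗[k] DualHopf k H) →ₐ[k] (H ⊗[k] DualHopf k H) ⊗[k] (H ⊗[k] DualHopf k H) := (shuffleAlgHom k H).comp (middleAlgHom k H)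
  let D : (H ⊗[k] DualHopf k H) →ₐ[k] (H ⊗[k] DualHopf k H) ⊗[k] (H ⊗[k] DualHopf k H) := (shuffleAlgHom k H).comp (splitAlgHom k H)
  let as : ((H ⊗[k] DualHopf k H) ⊗[k] (H ⊗[k] DualHopf k H)) ⊗[k] (H ⊗[k] DualHopf k H) →ₐ[k] (H ⊗[k] DualHopf k H) ⊗[k] ((H ⊗[k] DualHopf k H) ⊗[k] (H ⊗[k] DualHopf k H)) :=
    (Algebra.TensorProduct.assoc k k k _ _ _).toAlgHom
  let P12 : (H ⊗[k] DualHopf k H) →ₐ[k] (H ⊗[k] DualHopf k H) ⊗[k] ((H ⊗[k] DualHopf k H) ⊗[k] (H ⊗[k] DualHopf k H)) := (as.comp Algebra.TensorProduct.includeLeft).comp sm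
  let P23 : (H ⊗[k] DualHopf k H) →ₐ[k] (H ⊗[k] DualHopf k H) ⊗[k] ((H ⊗[k] DualHopf k H) ⊗[k] (H ⊗[k] DualHopf k H)) :=
    (Algebra.TensorProduct.includeRight : (H ⊗[k] DualHopf k H) ⊗[k] (H ⊗[k] DualHopf k H) →ₐ[k] (H ⊗[k] DualHopf k H) ⊗[k] ((H ⊗[k] DualHopf k H) ⊗[k] (H ⊗[k] DualHopf k H))).comp sm
  let G1 : (H ⊗[k] DualHopf k H) ⊗[k] (H ⊗[k] DualHopf k H) →ₐ[k] (H ⊗[k] DualHopf k H) ⊗[k] ((H ⊗[k] DualHopf k H) ⊗[k] (H ⊗[k] DualHopf k H)) :=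
    as.comp (Algebra.TensorProduct.map D (.id k (H ⊗[k] DualHopf k H)))
  let G2 : (H ⊗[k] DualHopf k H) ⊗[k] (H ⊗[k] DualHopf k H) →ₐ[k] (H ⊗[k] DualHopf k H) ⊗[k] ((H ⊗[k] DualHopf k H) ⊗[k] (H ⊗[k] DualHopf k H)) := Algebra.TensorProduct.map (.id k (H ⊗[k] DualHopf k H)) D
  let K : H ⊗[k] (DualHopf k H ⊗[k] DualHopf k H) →ₐ[k] (H ⊗[k] DualHopf k H) ⊗[k] ((H ⊗[k] DualHopf k H) ⊗[k] (H ⊗[k] DualHopf k H)) :=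
    as.comp ((Algebra.TensorProduct.comm k _ _).toAlgHom.comp
      (Algebra.TensorProduct.map inL (Algebra.TensorProduct.map inR inR)))
  let K' : (H ⊗[k] H) ⊗[k] DualHopf k H →ₐ[k] (H ⊗[k] DualHopf k H) ⊗[k] ((H ⊗[k] DualHopf k H) ⊗[k] (H ⊗[k] DualHopf k H)) :=
    (Algebra.TensorProduct.comm k _ _).toAlgHom.comp
      (Algebra.TensorProduct.map
        ((Algebra.TensorProduct.comm k _ _).toAlgHom.comp (Algebra.TensorProduct.map inL inL)) inR)
  let P13 : (H ⊗[k] DualHopf k H) →ₐ[k] (H ⊗[k] DualHopf k H) ⊗[k] ((H ⊗[k] DualHopf k H) ⊗[k] (H ⊗[k] DualHopf k H)) :=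
    K.comp (Algebra.TensorProduct.map (.id k H) Algebra.TensorProduct.includeLeft)
  let U : (H ⊗[k] DualHopf k H) := canonicalElement k H
  have hsm : ∀ (x : H) (θ : DualHopf k H), sm (x ⊗ₜ θ) = (1 ⊗ₜ θ) ⊗ₜ (x ⊗ₜ 1) := by
    intro x θ
    simp [sm, shuffleAlgHom, middleAlgHom]
  have a1 : G1.comp sm = K.comp
      (Algebra.TensorProduct.map (.id k H) (Bialgebra.comulAlgHom k (DualHopf k H))) := by
    apply AlgHom.toLinearMap_injective
    apply TensorProduct.ext'
    intro x θ
    simp only [AlgHom.toLinearMap_apply, AlgHom.comp_apply, hsm, G1, K, D,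
      Algebra.TensorProduct.map_tmul, split_right, AlgHom.coe_id, id_eq,
      Bialgebra.comulAlgHom_apply]
    rfl
  have a2 : K.comp (Algebra.TensorProduct.map (.id k H) Algebra.TensorProduct.includeRight) =
      P23 := by
    apply AlgHom.toLinearMap_injective
    apply TensorProduct.ext'
    intro x θ
    simp [P23, K, hsm, as, Algebra.TensorProduct.one_def]
  have b1 : G2.comp sm = K'.comp
      (Algebra.TensorProduct.map (Bialgebra.comulAlgHom k H) (.id k (DualHopf k H))) := by
    apply AlgHom.toLinearMap_injective
    apply TensorProduct.ext'
    intro x θ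
    simp only [AlgHom.toLinearMap_apply, AlgHom.comp_apply, hsm, G2, K', D,
      Algebra.TensorProduct.map_tmul, split_left, AlgHom.coe_id, id_eq,
      Bialgebra.comulAlgHom_apply]
    induction Coalgebra.comul (R := k) x with
    | zero => simp
    | add x y hx hy => simp only [map_add, TensorProduct.add_tmul, TensorProduct.tmul_add, hx, hy]
    | tmul x y => simp
  have b2 : K'.comp (Algebra.TensorProduct.map
      (Algebra.TensorProduct.includeLeft : H →ₐ[k] H ⊗[k] H) (.id k (DualHopf k H))) = P13 := by
    apply AlgHom.toLinearMap_injective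
    apply TensorProduct.ext'
    intro x θ
    simp [P13, K, K', as, Algebra.TensorProduct.one_def]
  have b3 : K'.comp (Algebra.TensorProduct.map
      (Algebra.TensorProduct.includeRight : H →ₐ[k] H ⊗[k] H) (.id k (DualHopf k H))) = P12 := by
    apply AlgHom.toLinearMap_injective
    apply TensorProduct.ext'
    intro x θ
    simp [P12, K', as, hsm, Algebra.TensorProduct.one_def]
  have hc : ∀ s t : (H ⊗[k] DualHopf k H), P12 s * P23 t = P23 t * P12 s := by
    intro s t
    refine commute_of_tmul P12 P23 ?_ s t
    intro x θ y φ
    simp [P12, P23, hsm, as]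
  have e1 : G1 (sm U) = P13 U * P23 U := by
    rw [← AlgHom.comp_apply, a1, AlgHom.comp_apply, canonicalElement_comul, map_mul, ← a2]
    rfl
  have e2 : G2 (sm U) = P13 U * P12 U := by
    rw [← AlgHom.comp_apply, b1, AlgHom.comp_apply, comul_canonicalElement, map_mul, ← b3, ← b2]
    rfl
  let V : ((H ⊗[k] DualHopf k H) ⊗[k] (H ⊗[k] DualHopf k H))ˣ := Units.map (sm : (H ⊗[k] DualHopf k H) →* (H ⊗[k] DualHopf k H) ⊗[k] (H ⊗[k] DualHopf k H)) (canonicalUnit k H)⁻¹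
  let u1 : ((H ⊗[k] DualHopf k H) ⊗[k] ((H ⊗[k] DualHopf k H) ⊗[k] (H ⊗[k] DualHopf k H)))ˣ := Units.map ((as.comp Algebra.TensorProduct.includeLeft :
    (H ⊗[k] DualHopf k H) ⊗[k] (H ⊗[k] DualHopf k H) →ₐ[k] (H ⊗[k] DualHopf k H) ⊗[k] ((H ⊗[k] DualHopf k H) ⊗[k] (H ⊗[k] DualHopf k H))) : _ →* _) V
  let u2 : ((H ⊗[k] DualHopf k H) ⊗[k] ((H ⊗[k] DualHopf k H) ⊗[k] (H ⊗[k] DualHopf k H)))ˣ := Units.map ((Algebra.TensorProduct.includeRight :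
    (H ⊗[k] DualHopf k H) ⊗[k] (H ⊗[k] DualHopf k H) →ₐ[k] (H ⊗[k] DualHopf k H) ⊗[k] ((H ⊗[k] DualHopf k H) ⊗[k] (H ⊗[k] DualHopf k H))) : _ →* _) V
  have key : u1 * Units.map (G1 : (H ⊗[k] DualHopf k H) ⊗[k] (H ⊗[k] DualHopf k H) →* _) V = u2 * Units.map (G2 : (H ⊗[k] DualHopf k H) ⊗[k] (H ⊗[k] DualHopf k H) →* _) V := by
    rw [← inv_inj, mul_inv_rev, mul_inv_rev]
    apply Units.ext
    change G1 (sm U) * P12 U = G2 (sm U) * P23 U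
    rw [e1, e2]
    exact mul_swap_right (P13 U) (P12 U) (P23 U) (hc U U)
  exact congrArg Units.val key

theorem codouble_coassoc :
    (Algebra.TensorProduct.assoc k k k _ _ _).toAlgHom.comp
      ((Algebra.TensorProduct.map (codoubleComul k H) (.id k _)).comp (codoubleComul k H)) =
        (Algebra.TensorProduct.map (.id k _) (codoubleComul k H)).comp (codoubleComul k H) := by
  rw [codoubleComul_eq]
  exact twist_coassoc _ _ split_coassoc twist_cocycle

theorem codouble_rTensor :
    (Algebra.TensorProduct.map (codoubleCounit k H) (.id k _)).comp (codoubleComul k H) =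
      (Algebra.TensorProduct.lid k (H ⊗[k] DualHopf k H)).symm := by
  let F := Algebra.TensorProduct.map (codoubleCounit k H) (.id k (H ⊗[k] DualHopf k H))
  have h0 : F (twistUnit⁻¹).val = 1 := by
    let K : H ⊗[k] k →ₐ[k] k ⊗[k] (H ⊗[k] DualHopf k H) :=
      (Algebra.TensorProduct.comm k _ _).toAlgHom.comp (Algebra.TensorProduct.map inL (.id k k))
    have : (F.comp ((shuffleAlgHom k H).comp (middleAlgHom k H))) =
        K.comp (Algebra.TensorProduct.map (.id k H) (Bialgebra.counitAlgHom k (DualHopf k H))) := by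
      apply AlgHom.toLinearMap_injective
      apply TensorProduct.ext'
      intro x θ
      simp [F, K, shuffleAlgHom, middleAlgHom, codoubleCounit]
    have h := congr($this (canonicalElement k H))
    rw [AlgHom.comp_apply, AlgHom.comp_apply (φ₁ := K), canonicalElement_counit, map_one] at h
    exact h
  have h1 : F twistUnit.val = 1 := by
    have h : F twistUnit.val * F (twistUnit⁻¹).val = 1 := by rw [← map_mul, Units.mul_inv, map_one]
    rwa [h0, mul_one] at h
  rw [codoubleComul_eq]
  have h2 : F.comp ((Ad twistUnit).comp ((shuffleAlgHom k H).comp (splitAlgHom k H))) =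
      F.comp ((shuffleAlgHom k H).comp (splitAlgHom k H)) := by
    apply AlgHom.ext; intro t
    simp only [AlgHom.comp_apply, Ad_apply, map_mul, h0, h1, one_mul, mul_one]
  refine h2.trans ?_
  apply Algebra.TensorProduct.ext
  · apply AlgHom.ext; intro h
    refine (congrArg F (split_left h)).trans ?_
    have : ∀ t : H ⊗[k] H, F (Algebra.TensorProduct.map inL inL (TensorProduct.comm k H H t)) =
        1 ⊗ₜ (TensorProduct.rid k H (Coalgebra.counit.lTensor H t) ⊗ₜ 1) := by
      intro t
      induction t with
      | zero => simp
      | add x y hx hy => simp only [map_add, TensorProduct.add_tmul, TensorProduct.tmul_add, hx, hy]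
      | tmul x y =>
        simp [F, codoubleCounit]
        rw [tmul_one_left, TensorProduct.smul_tmul']
    rw [this]
    simp
  · apply AlgHom.ext; intro θ
    refine (congrArg F (split_right θ)).trans ?_
    have : ∀ t : DualHopf k H ⊗[k] DualHopf k H, F (Algebra.TensorProduct.map inR inR t) =
        1 ⊗ₜ (1 ⊗ₜ TensorProduct.lid k _ (Coalgebra.counit.rTensor (DualHopf k H) t)) := by
      intro t
      induction t with
      | zero => simp
      | add x y hx hy => simp only [map_add, TensorProduct.tmul_add, hx, hy]
      | tmul x y =>
        simp [F, codoubleCounit]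
        exact (tmul_one_left _ _).trans (by simp)
    rw [this]
    simp

theorem codouble_lTensor :
    (Algebra.TensorProduct.map (.id k _) (codoubleCounit k H)).comp (codoubleComul k H) =
      (Algebra.TensorProduct.rid k k (H ⊗[k] DualHopf k H)).symm := by
  let F := Algebra.TensorProduct.map (.id k (H ⊗[k] DualHopf k H)) (codoubleCounit k H)
  have h0 : F (twistUnit⁻¹).val = 1 := by
    let K : k ⊗[k] DualHopf k H →ₐ[k] (H ⊗[k] DualHopf k H) ⊗[k] k :=
      (Algebra.TensorProduct.comm k _ _).toAlgHom.comp (Algebra.TensorProduct.map (.id k k) inR)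
    have : (F.comp ((shuffleAlgHom k H).comp (middleAlgHom k H))) =
        K.comp (Algebra.TensorProduct.map (Bialgebra.counitAlgHom k H) (.id k (DualHopf k H))) := by
      apply AlgHom.toLinearMap_injective
      apply TensorProduct.ext'
      intro x θ
      simp [F, K, shuffleAlgHom, middleAlgHom, codoubleCounit]
    have h := congr($this (canonicalElement k H))
    rw [AlgHom.comp_apply, AlgHom.comp_apply (φ₁ := K), counit_canonicalElement, map_one] at h
    exact h
  have h1 : F twistUnit.val = 1 := by
    have h : F twistUnit.val * F (twistUnit⁻¹).val = 1 := by rw [← map_mul, Units.mul_inv, map_one]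
    rwa [h0, mul_one] at h
  rw [codoubleComul_eq]
  have h2 : F.comp ((Ad twistUnit).comp ((shuffleAlgHom k H).comp (splitAlgHom k H))) =
      F.comp ((shuffleAlgHom k H).comp (splitAlgHom k H)) := by
    apply AlgHom.ext; intro t
    simp only [AlgHom.comp_apply, Ad_apply, map_mul, h0, h1, one_mul, mul_one]
  refine h2.trans ?_
  apply Algebra.TensorProduct.ext
  · apply AlgHom.ext; intro h
    refine (congrArg F (split_left h)).trans ?_
    have : ∀ t : H ⊗[k] H, F (Algebra.TensorProduct.map inL inL (TensorProduct.comm k H H t)) =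
        (TensorProduct.lid k H (Coalgebra.counit.rTensor H t) ⊗ₜ 1) ⊗ₜ 1 := by
      intro t
      induction t with
      | zero => simp
      | add x y hx hy => simp only [map_add, TensorProduct.add_tmul, TensorProduct.tmul_add, hx, hy]
      | tmul x y =>
        simp [F, codoubleCounit]
        rw [tmul_one_right, TensorProduct.smul_tmul']
    rw [this]
    simp
  · apply AlgHom.ext; intro θ
    refine (congrArg F (split_right θ)).trans ?_
    have : ∀ t : DualHopf k H ⊗[k] DualHopf k H, F (Algebra.TensorProduct.map inR inR t) =
        (1 ⊗ₜ TensorProduct.rid k _ (Coalgebra.counit.lTensor (DualHopf k H) t)) ⊗ₜ 1 := by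
      intro t
      induction t with
      | zero => simp
      | add x y hx hy => simp only [map_add, TensorProduct.add_tmul, TensorProduct.tmul_add, hx, hy]
      | tmul x y =>
        simp [F, codoubleCounit]
        rw [tmul_one_right, TensorProduct.smul_tmul']
    rw [this]
    simp

variable (k H)

/-- The Drinfeld codouble `𝒯_M(H) = H^co ⊗ Ĥ`: the tensor product algebra with the comultiplication
`codoubleComul`. -/
def MajidCodouble : Type (max u v) := H ⊗[k] DualHopf k H

instance : Ring (MajidCodouble k H) := inferInstanceAs (Ring (H ⊗[k] DualHopf k H))
instance : Algebra k (MajidCodouble k H) := inferInstanceAs (Algebra k (H ⊗[k] DualHopf k H))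

/-- The identification of the underlying algebra. -/
def MajidCodouble.equiv : MajidCodouble k H ≃ₐ[k] H ⊗[k] DualHopf k H where
  __ := Equiv.refl _
  map_mul' _ _ := rfl
  map_add' _ _ := rfl
  commutes' _ := rfl

instance : FiniteDimensional k (MajidCodouble k H) :=
  Module.Finite.equiv (MajidCodouble.equiv k H).symm.toLinearEquiv

instance : Bialgebra k (MajidCodouble k H) :=
  Bialgebra.ofAlgHom (A := MajidCodouble k H) (codoubleComul k H) (codoubleCounit k H)
    codouble_coassoc codouble_rTensor codouble_lTensor

end Codouble

section Double
variable (k : Type u) (H : Type v) [Field k] [Ring H] [HopfAlgebra k H] [FiniteDimensional k H]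

/-- `h ▶ ω = p(h, ω₂) ω₁`. -/
def leftCoregular : H →ₗ[k] DualHopf k H →ₗ[k] DualHopf k H :=
  LinearMap.mk₂ k (fun h ω => evalRight (DualHopf k H) h (Coalgebra.comul (R := k) ω))
    (by
      intro x y ω
      induction Coalgebra.comul (R := k) ω with
      | zero => simp
      | add s t hs ht => simp only [map_add, hs, ht]; abel
      | tmul s t => simp [add_smul])
    (by
      intro c x ω
      induction Coalgebra.comul (R := k) ω with
      | zero => simp
      | add s t hs ht => simp only [map_add, hs, ht, smul_add]
      | tmul s t => simp [mul_smul])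
    (by intros; simp) (by intros; simp)

/-- `h ◀ ω = p(h₁, ω) h₂`. -/
def rightCoregular : H →ₗ[k] DualHopf k H →ₗ[k] H :=
  LinearMap.mk₂ k (fun h ω => TensorProduct.lid k H
      (((pairing k H).flip ω).rTensor H (Coalgebra.comul (R := k) h)))
    (by intros; simp) (by intros; simp)
    (by intros; simp [LinearMap.rTensor_add]) (by intros; simp [LinearMap.rTensor_smul])

/-- `𝔗(h ⊗ θ) = (h₂ ▶ θ₂) ⊗ (h₁ ◀ Ŝ(θ₁))`. -/
def straighten : H ⊗[k] DualHopf k H →ₗ[k] DualHopf k H ⊗[k] H :=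
  (TensorProduct.comm k H (DualHopf k H)).toLinearMap ∘ₗ
    TensorProduct.map
      (TensorProduct.lift (rightCoregular k H) ∘ₗ
        (HopfAlgebra.antipode k (A := DualHopf k H)).lTensor H)
      (TensorProduct.lift (leftCoregular k H)) ∘ₗ
    (TensorProduct.tensorTensorTensorComm k H H (DualHopf k H) (DualHopf k H)).toLinearMap ∘ₗ
    TensorProduct.map Coalgebra.comul Coalgebra.comul

/-- `(m_{Ĥ^op} ⊗ m_H) (id ⊗ 𝔗 ⊗ id)`, that is
`(ω ⋈ h)(θ ⋈ g) = ((h₂ ▶ θ₂) ω) ⋈ ((h₁ ◀ Ŝ(θ₁)) g)`. -/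
def doubleMul : DualHopf k H ⊗[k] H →ₗ[k] DualHopf k H ⊗[k] H →ₗ[k] DualHopf k H ⊗[k] H :=
  TensorProduct.curry
    (TensorProduct.map
        (LinearMap.mul' k (DualHopf k H) ∘ₗ (TensorProduct.comm k _ _).toLinearMap)
        (LinearMap.mul' k H) ∘ₗ
      (TensorProduct.assoc k (DualHopf k H) (DualHopf k H) (H ⊗[k] H)).symm.toLinearMap ∘ₗ
      ((TensorProduct.assoc k (DualHopf k H) H H).toLinearMap ∘ₗ
        (straighten k H).rTensor H ∘ₗ
        (TensorProduct.assoc k H (DualHopf k H) H).symm.toLinearMap).lTensor (DualHopf k H) ∘ₗ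
      (TensorProduct.assoc k (DualHopf k H) H (DualHopf k H ⊗[k] H)).toLinearMap)

/-- `𝒫(ω ⋈ h, g ⊗ θ) = ω(g) θ(h)`. -/
def doublePairing : DualHopf k H ⊗[k] H →ₗ[k] Module.Dual k (H ⊗[k] DualHopf k H) :=
  TensorProduct.dualDistrib k H (DualHopf k H) ∘ₗ
    TensorProduct.map (DualHopf.equiv k H).toLinearMap (pairing k H)

variable {k H}

@[simp] theorem leftCoregular_apply (h : H) (ω : DualHopf k H) :
    leftCoregular k H h ω = evalRight (DualHopf k H) h (Coalgebra.comul (R := k) ω) := rfl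

theorem rightCoregular_apply {ι : Type*} {h : H} (r : Coalgebra.Repr k h ι) (ω : DualHopf k H) :
    rightCoregular k H h ω = ∑ i ∈ r.index, pairing k H (r.left i) ω • r.right i := by
  simp [rightCoregular, ← r.eq]

@[simp] theorem doublePairing_tmul (ω : DualHopf k H) (h g : H) (θ : DualHopf k H) :
    doublePairing k H (ω ⊗ₜ h) (g ⊗ₜ θ) = pairing k H g ω * pairing k H h θ := rfl

theorem pairing_antipode (h : H) (θ : DualHopf k H) :
    pairing k H h (HopfAlgebra.antipode k θ) = pairing k H (HopfAlgebra.antipode k h) θ := rfl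

theorem doubleMul_tmul (ω θ : DualHopf k H) (h g : H) :
    doubleMul k H (ω ⊗ₜ h) (θ ⊗ₜ g) =
      TensorProduct.map (LinearMap.mulRight k ω) (LinearMap.mulRight k g)
        (straighten k H (h ⊗ₜ θ)) := by
  simp only [doubleMul, TensorProduct.curry_apply, LinearMap.comp_apply, LinearEquiv.coe_coe,
    TensorProduct.assoc_tmul, LinearMap.lTensor_tmul, TensorProduct.assoc_symm_tmul,
    LinearMap.rTensor_tmul]
  induction straighten k H (h ⊗ₜ θ) with
  | zero => simp
  | add x y hx hy => simp only [map_add, TensorProduct.add_tmul, TensorProduct.tmul_add, hx, hy]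
  | tmul x y => simp

theorem doublePairing_injective : Function.Injective (doublePairing k H) := by
  have h1 : Function.Injective (pairing k H) := by
    intro x y hxy
    apply (Module.evalEquiv k H).injective
    ext f
    exact congr($hxy ((DualHopf.equiv k H).symm f))
  have h2 : Function.Injective (TensorProduct.map (DualHopf.equiv k H).toLinearMap (pairing k H)) :=
    TensorProduct.map_injective_of_flat_flat _ _ (DualHopf.equiv k H).injective h1
  exact (TensorProduct.dualDistribEquiv k H (DualHopf k H)).injective.comp h2

theorem map_straighten {ι κ : Type*} {h : H} (r : Coalgebra.Repr k h ι) {a : H}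
    (l : Coalgebra.Repr k a κ)
    (ω φ θ : DualHopf k H) (g : H) :
    doublePairing k H (doubleMul k H (ω ⊗ₜ h) (φ ⊗ₜ g)) (a ⊗ₜ θ) =
      ∑ i ∈ r.index, ∑ j ∈ (Coalgebra.Repr.arbitrary k (r.left i)).index, ∑ m ∈ l.index,
        pairing k H (HopfAlgebra.antipode k ((Coalgebra.Repr.arbitrary k (r.left i)).left j) *
            (l.left m * r.right i)) φ * pairing k H (l.right m) ω *
          pairing k H ((Coalgebra.Repr.arbitrary k (r.left i)).right j * g) θ := by
  let T : DualHopf k H ⊗[k] DualHopf k H →ₗ[k] DualHopf k H ⊗[k] H :=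
      (TensorProduct.comm k H (DualHopf k H)).toLinearMap ∘ₗ
    TensorProduct.map
      (TensorProduct.lift (rightCoregular k H) ∘ₗ
        (HopfAlgebra.antipode k (A := DualHopf k H)).lTensor H)
      (TensorProduct.lift (leftCoregular k H)) ∘ₗ
    (TensorProduct.tensorTensorTensorComm k H H (DualHopf k H) (DualHopf k H)).toLinearMap ∘ₗ
    TensorProduct.mk k _ _ (Coalgebra.comul h)
  have hT : straighten k H (h ⊗ₜ φ) = T (Coalgebra.comul φ) := rfl
  have key : ∀ t, doublePairing k H (TensorProduct.map (LinearMap.mulRight k ω)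
      (LinearMap.mulRight k g) (T t)) (a ⊗ₜ θ) =
      ∑ i ∈ r.index, ∑ j ∈ (Coalgebra.Repr.arbitrary k (r.left i)).index, ∑ m ∈ l.index,
        pairing k H (l.left m * r.right i) (evalLeft (DualHopf k H)
          (HopfAlgebra.antipode k ((Coalgebra.Repr.arbitrary k (r.left i)).left j)) t) *
          pairing k H (l.right m) ω *
          pairing k H ((Coalgebra.Repr.arbitrary k (r.left i)).right j * g) θ := by
    intro t
    induction t with
    | zero => simp
    | add x y hx hy =>
      simp only [map_add, LinearMap.add_apply, hx, hy, add_mul, Finset.sum_add_distrib]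
    | tmul x y =>
      simp only [T, LinearMap.comp_apply, TensorProduct.mk_apply, ← r.eq,
        map_sum, LinearMap.sum_apply, LinearEquiv.coe_coe,
        TensorProduct.tensorTensorTensorComm_tmul, TensorProduct.map_tmul,
        TensorProduct.comm_tmul, LinearMap.lTensor_tmul, TensorProduct.lift.tmul,
        LinearMap.mulRight_apply, doublePairing_tmul, leftCoregular_apply]
      refine Finset.sum_congr rfl fun i _ => ?_
      rw [rightCoregular_apply (Coalgebra.Repr.arbitrary k (r.left i)), pairing_mul l]
      simp only [pairing_evalRight_comul, Finset.sum_mul, map_sum, LinearMap.sum_apply,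
        Finset.mul_sum, pairing_antipode, evalLeft_tmul, map_smul, LinearMap.smul_apply,
        smul_eq_mul, smul_mul_assoc]
      refine Finset.sum_congr rfl fun j _ => Finset.sum_congr rfl fun m _ => ?_
      ring
  rw [doubleMul_tmul, hT, key]
  simp only [dual_comul_pairing]

end Double

section Double
variable (k : Type u) (H : Type v) [Field k] [Ring H] [HopfAlgebra k H] [FiniteDimensional k H]

/-- The pairing as a map into the dual of the codouble. -/
def doubleToDual : DualHopf k H ⊗[k] H →ₗ[k] DualHopf k (MajidCodouble k H) :=
  (DualHopf.equiv k (MajidCodouble k H)).symm.toLinearMap ∘ₗ doublePairing k H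

variable {k H}

theorem doubleToDual_injective : Function.Injective (doubleToDual k H) :=
  (DualHopf.equiv k (MajidCodouble k H)).symm.injective.comp doublePairing_injective

theorem pairing_shuffle (ω φ : DualHopf k H) (h g : H) (s s' : H ⊗[k] DualHopf k H)
    (a b : H) (u v : DualHopf k H) :
    LinearMap.mul' k k (TensorProduct.map (doublePairing k H (ω ⊗ₜ h)) (doublePairing k H (φ ⊗ₜ g))
      (shuffleAlgHom k H (middleAlgHom k H s * ((a ⊗ₜ b) ⊗ₜ (u ⊗ₜ v)) * middleAlgHom k H s'))) =
    pairing k H a ω * pairing k H g v *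
      pairing k H (evalRight H h (s * (b ⊗ₜ u) * s')) φ := by
  induction s with
  | zero => simp
  | add x y hx hy =>
    simp only [map_add, add_mul, mul_add, LinearMap.add_apply, hx, hy]
  | tmul x θ =>
    induction s' with
    | zero => simp
    | add x y hx hy =>
      simp only [map_add, add_mul, mul_add, LinearMap.add_apply, hx, hy]
    | tmul y θ' =>
      simp [middleAlgHom, shuffleAlgHom]
      ring

theorem pairing_comul (ω φ : DualHopf k H) (h g a : H) (θ : DualHopf k H) {ι κ : Type*}
    (r : Coalgebra.Repr k h ι) (l : Coalgebra.Repr k a κ) :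
    LinearMap.mul' k k (TensorProduct.map (doublePairing k H (ω ⊗ₜ h)) (doublePairing k H (φ ⊗ₜ g))
      (codoubleComul k H (a ⊗ₜ θ))) =
      ∑ i ∈ r.index, ∑ j ∈ (Coalgebra.Repr.arbitrary k (r.left i)).index, ∑ m ∈ l.index,
        pairing k H (HopfAlgebra.antipode k ((Coalgebra.Repr.arbitrary k (r.left i)).left j) *
            (l.left m * r.right i)) φ * pairing k H (l.right m) ω *
          pairing k H ((Coalgebra.Repr.arbitrary k (r.left i)).right j * g) θ := by
  have key : ∀ t : DualHopf k H ⊗[k] DualHopf k H,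
      LinearMap.mul' k k (TensorProduct.map (doublePairing k H (ω ⊗ₜ h))
        (doublePairing k H (φ ⊗ₜ g)) (shuffleAlgHom k H
          (middleAlgHom k H (↑(canonicalUnit k H)⁻¹) *
            ((TensorProduct.comm k H H (Coalgebra.comul a)) ⊗ₜ t) *
            middleAlgHom k H (canonicalUnit k H)))) =
      ∑ i ∈ r.index, ∑ j ∈ (Coalgebra.Repr.arbitrary k (r.left i)).index, ∑ m ∈ l.index,
        pairing k H (HopfAlgebra.antipode k ((Coalgebra.Repr.arbitrary k (r.left i)).left j) *
            (l.left m * r.right i)) φ * pairing k H (l.right m) ω *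
          pairing k H g (evalLeft (DualHopf k H)
            ((Coalgebra.Repr.arbitrary k (r.left i)).right j) t) := by
    intro t
    induction t with
    | zero => simp
    | add x y hx hy =>
      simp only [map_add, TensorProduct.tmul_add, add_mul, mul_add, LinearMap.add_apply, hx, hy,
        Finset.sum_add_distrib]
    | tmul x y =>
      simp only [← l.eq, map_sum, TensorProduct.comm_tmul, TensorProduct.sum_tmul,
        Finset.mul_sum, Finset.sum_mul, pairing_shuffle]
      have e1 : ∀ b : H, evalRight H h ((canonicalUnit k H)⁻¹.val * (b ⊗ₜ x) * (canonicalUnit k H).val)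
          = ∑ i ∈ r.index, ∑ j ∈ (Coalgebra.Repr.arbitrary k (r.left i)).index,
            pairing k H ((Coalgebra.Repr.arbitrary k (r.left i)).right j) x •
              (HopfAlgebra.antipode k ((Coalgebra.Repr.arbitrary k (r.left i)).left j) *
                (b * r.right i)) := by
        intro b
        rw [evalRight_mul r]
        refine Finset.sum_congr rfl fun i _ => ?_
        rw [evalRight_mul (Coalgebra.Repr.arbitrary k (r.left i)), Finset.sum_mul]
        refine Finset.sum_congr rfl fun j _ => ?_
        change evalRight H _ ((HopfAlgebra.antipode k).rTensor _ (canonicalElement k H)) * _ *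
          evalRight H _ (canonicalElement k H) = _
        rw [evalRight_map, evalRight_canonicalElement, evalRight_canonicalElement, evalRight_tmul]
        simp [mul_assoc]
      simp only [e1, map_sum, LinearMap.sum_apply, Finset.mul_sum]
      rw [Finset.sum_comm]
      refine Finset.sum_congr rfl fun i _ => ?_
      rw [Finset.sum_comm]
      refine Finset.sum_congr rfl fun j _ => Finset.sum_congr rfl fun m _ => ?_
      simp
      ring
  have h1 : codoubleComul k H (a ⊗ₜ θ) = shuffleAlgHom k H
          (middleAlgHom k H (↑(canonicalUnit k H)⁻¹) *
            ((TensorProduct.comm k H H (Coalgebra.comul a)) ⊗ₜ (Coalgebra.comul θ)) *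
            middleAlgHom k H (canonicalUnit k H)) := by
    simp only [codoubleComul, AlgHom.comp_apply, Ad_apply]
    rfl
  rw [h1, key]
  simp only [dual_comul_pairing]

theorem doubleToDual_mul (d e : DualHopf k H ⊗[k] H) :
    doubleToDual k H (doubleMul k H d e) = doubleToDual k H d * doubleToDual k H e := by
  induction d with
  | zero => simp
  | add x y hx hy => simp only [map_add, add_mul, LinearMap.add_apply, hx, hy]
  | tmul ω h =>
    induction e with
    | zero => simp
    | add x y hx hy => simp only [map_add, mul_add, hx, hy]
    | tmul φ g =>
      apply DualHopf.ext_pairing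
      intro t
      change doublePairing k H _ t = LinearMap.mul' k k (TensorProduct.map
        (doublePairing k H (ω ⊗ₜ h)) (doublePairing k H (φ ⊗ₜ g)) (codoubleComul k H t))
      induction t using TensorProduct.induction_on with
      | zero => exact (map_zero _).trans (by simp)
      | add x y hx hy => exact (map_add _ x y).trans (by rw [hx, hy]; simp only [map_add])
      | tmul a θ =>
        rw [pairing_comul ω φ h g a θ (Coalgebra.Repr.arbitrary k h) (Coalgebra.Repr.arbitrary k a),
          map_straighten (Coalgebra.Repr.arbitrary k h) (Coalgebra.Repr.arbitrary k a)]

theorem doubleToDual_one : doubleToDual k H (1 ⊗ₜ 1) = 1 := by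
  apply DualHopf.ext_pairing
  intro t
  change doublePairing k H (1 ⊗ₜ 1) t = codoubleCounit k H t
  induction t using TensorProduct.induction_on with
  | zero => exact (map_zero _).trans (by simp)
  | add x y hx hy => exact (map_add _ x y).trans (by rw [hx, hy]; simp only [map_add])
  | tmul a θ => simp [codoubleCounit]

variable (k H)

/-- Majid's Drinfeld double `𝒟_M(H) = Ĥ^op ⋈ H`: the tensor product coalgebra `Ĥ ⊗ H` with the
multiplication `doubleMul`. -/
def MajidDouble : Type (max u v) := DualHopf k H ⊗[k] H

instance : AddCommGroup (MajidDouble k H) := inferInstanceAs (AddCommGroup (DualHopf k H ⊗[k] H))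
instance : Module k (MajidDouble k H) := inferInstanceAs (Module k (DualHopf k H ⊗[k] H))

/-- The identification of the underlying space. -/
def MajidDouble.equiv : MajidDouble k H ≃ₗ[k] DualHopf k H ⊗[k] H := LinearEquiv.refl _ _

/-- The embedding `d ↦ 𝒫(d, ·)`, which is used to check the axioms. -/
def MajidDouble.toDual : MajidDouble k H →ₗ[k] DualHopf k (MajidCodouble k H) :=
  doubleToDual k H ∘ₗ (MajidDouble.equiv k H).toLinearMap

instance : Mul (MajidDouble k H) where
  mul d e := (MajidDouble.equiv k H).symm
    (doubleMul k H (MajidDouble.equiv k H d) (MajidDouble.equiv k H e))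

instance : One (MajidDouble k H) where
  one := (MajidDouble.equiv k H).symm (1 ⊗ₜ 1)

variable {k H}
theorem MajidDouble.toDual_injective : Function.Injective (MajidDouble.toDual k H) :=
  doubleToDual_injective

theorem MajidDouble.toDual_mul (d e : MajidDouble k H) :
    MajidDouble.toDual k H (d * e) = MajidDouble.toDual k H d * MajidDouble.toDual k H e :=
  doubleToDual_mul d e

theorem MajidDouble.toDual_one : MajidDouble.toDual k H 1 = 1 := doubleToDual_one

instance : Ring (MajidDouble k H) where
  __ := (inferInstance : AddCommGroup (MajidDouble k H))
  mul_assoc a b c := MajidDouble.toDual_injective (by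
    simp only [MajidDouble.toDual_mul, mul_assoc])
  one_mul a := MajidDouble.toDual_injective (by
    simp only [MajidDouble.toDual_mul, MajidDouble.toDual_one, one_mul])
  mul_one a := MajidDouble.toDual_injective (by
    simp only [MajidDouble.toDual_mul, MajidDouble.toDual_one, mul_one])
  left_distrib a b c := MajidDouble.toDual_injective (by
    simp only [MajidDouble.toDual_mul, map_add, mul_add])
  right_distrib a b c := MajidDouble.toDual_injective (by
    simp only [MajidDouble.toDual_mul, map_add, add_mul])
  zero_mul a := MajidDouble.toDual_injective (by
    simp only [MajidDouble.toDual_mul, map_zero, zero_mul])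
  mul_zero a := MajidDouble.toDual_injective (by
    simp only [MajidDouble.toDual_mul, map_zero, mul_zero])

instance : Algebra k (MajidDouble k H) := Algebra.ofModule
  (fun c x y => MajidDouble.toDual_injective (by
    simp only [MajidDouble.toDual_mul, map_smul, smul_mul_assoc]))
  (fun c x y => MajidDouble.toDual_injective (by
    simp only [MajidDouble.toDual_mul, map_smul, mul_smul_comm]))

instance : Coalgebra k (MajidDouble k H) :=
  inferInstanceAs (Coalgebra k (DualHopf k H ⊗[k] H))

theorem doublePairing_mul (ω θ φ : DualHopf k H) (a b h : H) :
    pairing k (MajidCodouble k H) (b ⊗ₜ φ : H ⊗[k] DualHopf k H)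
      (evalLeft (DualHopf k (MajidCodouble k H)) (B := MajidCodouble k H)
        (a ⊗ₜ θ : H ⊗[k] DualHopf k H)
        (TensorProduct.map (doubleToDual k H) (doubleToDual k H)
          (Coalgebra.comul (R := k) (ω ⊗ₜ[k] h)))) =
      doublePairing k H (ω ⊗ₜ h) ((a * b) ⊗ₜ (θ * φ)) := by
  rw [TensorProduct.comul_tmul, doublePairing_tmul,
    pairing_mul (Coalgebra.Repr.arbitrary k h), ← dual_comul_pairing]
  nth_rw 1 [← (Coalgebra.Repr.arbitrary k h).eq]
  induction Coalgebra.comul (R := k) ω with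
  | zero => simp
  | add x y hx hy => simp only [map_add, TensorProduct.add_tmul, add_mul, hx, hy]
  | tmul x y =>
    simp only [TensorProduct.tmul_sum, map_sum, Finset.mul_sum,
      TensorProduct.AlgebraTensorModule.tensorTensorTensorComm_tmul, TensorProduct.map_tmul,
      evalLeft_tmul, map_smul, smul_eq_mul]
    refine Finset.sum_congr rfl fun i _ => ?_
    change (doublePairing k H (x ⊗ₜ _) (a ⊗ₜ θ)) * (doublePairing k H (y ⊗ₜ _) (b ⊗ₜ φ)) = _
    simp only [doublePairing_tmul]
    ring

theorem evalLeft_add {B : Type*} [Ring B] [Bialgebra k B] {M : Type*} [AddCommMonoid M] [Module k M]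
    (b c : B) (t : DualHopf k B ⊗[k] M) : evalLeft M (b + c) t = evalLeft M b t + evalLeft M c t := by
  simp [evalLeft, LinearMap.rTensor_add]

theorem MajidDouble.induction {p : MajidDouble k H → Prop} (zero : p 0)
    (tmul : ∀ ω h, p ((MajidDouble.equiv k H).symm (ω ⊗ₜ h)))
    (add : ∀ x y, p x → p y → p (x + y)) (d : MajidDouble k H) : p d :=
  TensorProduct.induction_on (motive := p) d zero tmul add

theorem MajidCodouble.induction {p : MajidCodouble k H → Prop} (zero : p 0)
    (tmul : ∀ h ω, p ((MajidCodouble.equiv k H).symm (h ⊗ₜ ω)))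
    (add : ∀ x y, p x → p y → p (x + y)) (t : MajidCodouble k H) : p t :=
  TensorProduct.induction_on (motive := p) t zero tmul add

theorem MajidDouble.toDual_comul (d : MajidDouble k H) :
    TensorProduct.map (MajidDouble.toDual k H) (MajidDouble.toDual k H)
      (Coalgebra.comul (R := k) d) = Coalgebra.comul (R := k) (MajidDouble.toDual k H d) := by
  refine evalLeft_ext (B := MajidCodouble k H) fun s => DualHopf.ext_pairing fun t => ?_
  rw [dual_comul_pairing]
  induction d using MajidDouble.induction with
  | zero => simp
  | add x y hx hy => simp only [map_add, hx, hy]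
  | tmul ω h =>
    induction s using MajidCodouble.induction with
    | zero => simp [evalLeft]
    | add x y hx hy => simp only [evalLeft_add, add_mul, map_add, LinearMap.add_apply, hx, hy]
    | tmul a θ =>
      induction t using MajidCodouble.induction with
      | zero => simp
      | add x y hx hy => simp only [mul_add, map_add, LinearMap.add_apply, hx, hy]
      | tmul b φ =>
        refine (doublePairing_mul ω θ φ a b h).trans ?_
        refine congrArg (doublePairing k H (ω ⊗ₜ h)) ?_
        exact (Algebra.TensorProduct.tmul_mul_tmul a b θ φ).symm

theorem MajidDouble.counit_toDual (d : MajidDouble k H) :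
    Coalgebra.counit (R := k) (MajidDouble.toDual k H d) = Coalgebra.counit (R := k) d := by
  change doublePairing k H d (1 ⊗ₜ 1) = Coalgebra.counit (R := k) (A := DualHopf k H ⊗[k] H) d
  induction d using TensorProduct.induction_on with
  | zero => exact congr($(map_zero (doublePairing k H)) _).trans (by simp)
  | add x y hx hy => exact congr($(map_add (doublePairing k H) x y) _).trans (by 
      rw [LinearMap.add_apply, hx, hy]; exact (map_add _ x y).symm)
  | tmul a θ => simp [mul_comm]

instance : Bialgebra k (MajidDouble k H) := by
  have hm : ∀ s t, TensorProduct.map (MajidDouble.toDual k H) (MajidDouble.toDual k H) (s * t) =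
      TensorProduct.map (MajidDouble.toDual k H) (MajidDouble.toDual k H) s *
      TensorProduct.map (MajidDouble.toDual k H) (MajidDouble.toDual k H) t := by
    intro s t
    induction s with
    | zero => simp
    | add x y hx hy => simp only [map_add, add_mul, hx, hy]
    | tmul x y =>
      induction t with
      | zero => simp
      | add x y hx hy => simp only [map_add, mul_add, hx, hy]
      | tmul x y => simp [MajidDouble.toDual_mul]
  have hi : Function.Injective
      (TensorProduct.map (MajidDouble.toDual k H) (MajidDouble.toDual k H)) :=
    TensorProduct.map_injective_of_flat_flat _ _ MajidDouble.toDual_injective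
      MajidDouble.toDual_injective
  refine Bialgebra.mk' k (MajidDouble k H) ?_ ?_ ?_ ?_
  · rw [← MajidDouble.counit_toDual, MajidDouble.toDual_one, Bialgebra.counit_one]
  · intro d e
    simp only [← MajidDouble.counit_toDual, MajidDouble.toDual_mul, Bialgebra.counit_mul]
  · apply hi
    rw [MajidDouble.toDual_comul, MajidDouble.toDual_one, Bialgebra.comul_one,
      Algebra.TensorProduct.one_def, Algebra.TensorProduct.one_def, TensorProduct.map_tmul,
      MajidDouble.toDual_one]
  · intro d e
    apply hi
    simp only [hm, MajidDouble.toDual_comul, MajidDouble.toDual_mul, Bialgebra.comul_mul]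

end Double

section Structures
variable {k : Type u} {B : Type v} {X : Type w} [Field k] [Ring B] [Bialgebra k B] [Ring X]
  [Algebra k X]

/-- `ρ : X → X ⊗ B` is a right coaction of `B` on the algebra `X`. -/
structure IsRightCoaction (ρ : X →ₐ[k] X ⊗[k] B) : Prop where
  coassoc : ∀ x, TensorProduct.assoc k X B B (ρ.toLinearMap.rTensor B (ρ x)) =
    (Coalgebra.comul (R := k)).lTensor X (ρ x)
  counit : ∀ x, TensorProduct.rid k X ((Coalgebra.counit (R := k)).lTensor X (ρ x)) = x

/-- `δ : X → B ⊗ X` is a left coaction of `B` on the algebra `X`. -/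
structure IsLeftCoaction (δ : X →ₐ[k] B ⊗[k] X) : Prop where
  coassoc : ∀ x, δ.toLinearMap.lTensor B (δ x) =
    TensorProduct.assoc k B B X ((Coalgebra.comul (R := k)).rTensor X (δ x))
  counit : ∀ x, TensorProduct.lid k X ((Coalgebra.counit (R := k)).rTensor X (δ x)) = x

/-- `b ▷ x = act b x` makes `X` a left `B`-module algebra. -/
structure IsModuleAlgebra (act : B →ₗ[k] X →ₗ[k] X) : Prop where
  one_act : ∀ x, act 1 x = x
  mul_act : ∀ a b x, act (a * b) x = act a (act b x)
  act_one : ∀ b, act b 1 = Coalgebra.counit (R := k) b • (1 : X)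
  act_mul : ∀ b x y, act b (x * y) = LinearMap.mul' k X
    (TensorProduct.map (act.flip x) (act.flip y) (Coalgebra.comul (R := k) b))

/-- The condition
`h₁ x₍₋₁₎ ⊗ (h₂ ▷ x₍₀₎) = (h₁ ▷ x)₍₋₁₎ h₂ ⊗ (h₁ ▷ x)₍₀₎` for a left-left Yetter-Drinfeld algebra. -/
structure IsYDll (act : B →ₗ[k] X →ₗ[k] X) (δ : X →ₐ[k] B ⊗[k] X) : Prop where
  moduleAlgebra : IsModuleAlgebra act
  coaction : IsLeftCoaction δ
  compat : ∀ h x,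
    TensorProduct.map (LinearMap.mul' k B) (TensorProduct.lift act)
        (TensorProduct.tensorTensorTensorComm k B B B X (Coalgebra.comul (R := k) h ⊗ₜ[k] δ x)) =
      LinearMap.mul' k (B ⊗[k] X) (TensorProduct.map (δ.toLinearMap ∘ₗ act.flip x)
        (Algebra.TensorProduct.includeLeft : B →ₐ[k] B ⊗[k] X).toLinearMap
        (Coalgebra.comul (R := k) h))

/-- `b ▷ x = (id ⊗ p(b, ·)) (ρ x)`, for `ρ : X → X ⊗ B̂`. -/
def dualAction (ρ : X →ₐ[k] X ⊗[k] DualHopf k B) : B →ₗ[k] X →ₗ[k] X :=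
  LinearMap.mk₂ k (fun b x => evalRight X b (ρ x))
    (by intros; simp [evalRight, LinearMap.lTensor_add])
    (by intros; simp [evalRight, LinearMap.lTensor_smul])
    (by intros; simp) (by intros; simp)

/-- `x ◁ ω = (p(·, ω) ⊗ id) (δ x)`, for `δ : X → B ⊗ X`. -/
def dualRightAction (δ : X →ₐ[k] B ⊗[k] X) : DualHopf k B →ₗ[k] X →ₗ[k] X :=
  LinearMap.mk₂ k (fun ω x => TensorProduct.lid k X (((pairing k B).flip ω).rTensor X (δ x)))
    (by intros; simp [LinearMap.rTensor_add])
    (by intros; simp [LinearMap.rTensor_smul])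
    (by intros; simp) (by intros; simp)

end Structures

section Double
variable {k : Type u} {H : Type v} {X : Type w} [Field k] [Ring H] [HopfAlgebra k H]
  [FiniteDimensional k H] [Ring X] [Algebra k X]

/-- `h ⊗ ω ↦ h ⊗ (1 ⊗ ω)`, so that `U₁₃ = legs13 U`. -/
def legs13 : H ⊗[k] DualHopf k H →ₐ[k] H ⊗[k] (X ⊗[k] DualHopf k H) :=
  Algebra.TensorProduct.map (AlgHom.id k H) Algebra.TensorProduct.includeRight

/-- `α` and `β` make `X` a left-right Yetter-Drinfeld algebra:
`(α ⊗ id) β = Ad(U₁₃) (id ⊗ β) α`. -/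
structure IsYDlr (α : X →ₐ[k] H ⊗[k] X) (β : X →ₐ[k] X ⊗[k] DualHopf k H) : Prop where
  left : IsLeftCoaction α
  right : IsRightCoaction β
  compat : ∀ x,
    TensorProduct.assoc k H X (DualHopf k H) (α.toLinearMap.rTensor (DualHopf k H) (β x)) =
      Ad (k := k) (Units.map
          ((legs13 : H ⊗[k] DualHopf k H →ₐ[k] H ⊗[k] (X ⊗[k] DualHopf k H)) : _ →* _)
          (canonicalUnit k H))
        (β.toLinearMap.lTensor H (α x))

/-- `γ = (Σ α ⊗ id) β : X → X ⊗ (H^co ⊗ Ĥ)`. -/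
def codoubleCoaction (α : X →ₐ[k] H ⊗[k] X) (β : X →ₐ[k] X ⊗[k] DualHopf k H) :
    X →ₐ[k] X ⊗[k] MajidCodouble k H :=
  (Algebra.TensorProduct.map (AlgHom.id k X) (MajidCodouble.equiv k H).symm.toAlgHom).comp <|
    (Algebra.TensorProduct.assoc k k k X H (DualHopf k H)).toAlgHom.comp <|
    (Algebra.TensorProduct.map ((Algebra.TensorProduct.comm k H X).toAlgHom.comp α)
      (AlgHom.id k (DualHopf k H))).comp β

variable (k H)
/-- `𝒫(ω ⋈ h, g ⊗ θ) = ω(g) θ(h)` as a pairing of the double with the codouble. -/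
def MajidDouble.pairing : MajidDouble k H →ₗ[k] Module.Dual k (MajidCodouble k H) :=
  (MajidCodouble.equiv k H).toLinearMap.dualMap ∘ₗ doublePairing k H ∘ₗ
    (MajidDouble.equiv k H).toLinearMap

variable {k H}

/-- `d ▷ x = (id ⊗ 𝒫(d, ·)) (γ x)`. -/
def doubleAction (γ : X →ₐ[k] X ⊗[k] MajidCodouble k H) : MajidDouble k H →ₗ[k] X →ₗ[k] X :=
  LinearMap.mk₂ k (fun d x => TensorProduct.rid k X
      ((MajidDouble.pairing k H d).lTensor X (γ x)))
    (by intros; simp [LinearMap.lTensor_add])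
    (by intros; simp [LinearMap.lTensor_smul])
    (by intros; simp) (by intros; simp)

/-- `(ω ⋈ h) · x = (p(·, ω) ⊗ id) (δ (h ▷ x)) = (h ▷ x) ◁ ω`. -/
def majidAction (act : H →ₗ[k] X →ₗ[k] X) (δ : X →ₐ[k] H ⊗[k] X) :
    MajidDouble k H →ₗ[k] X →ₗ[k] X :=
  TensorProduct.lift ((LinearMap.mul k (Module.End k X)).compl₁₂ (dualRightAction δ) act) ∘ₗ
    (MajidDouble.equiv k H).toLinearMap

end Double

open CategoryTheory

section Categories

/-- Right `B`-comodule algebras. -/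
structure ComodAlg (k : Type u) (B : Type v) [Field k] [Ring B] [Bialgebra k B] :
    Type (max u v (w + 1)) where
  carrier : Type w
  [ring : Ring carrier]
  [algebra : Algebra k carrier]
  coact : carrier →ₐ[k] carrier ⊗[k] B
  isCoaction : IsRightCoaction coact

/-- Left `B`-module algebras. -/
structure ModAlg (k : Type u) (B : Type v) [Field k] [Ring B] [Bialgebra k B] :
    Type (max u v (w + 1)) where
  carrier : Type w
  [ring : Ring carrier]
  [algebra : Algebra k carrier]
  act : B →ₗ[k] carrier →ₗ[k] carrier
  isModuleAlgebra : IsModuleAlgebra act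

/-- Left-left Yetter-Drinfeld algebras over `B`. -/
structure YDll (k : Type u) (B : Type v) [Field k] [Ring B] [Bialgebra k B] :
    Type (max u v (w + 1)) where
  carrier : Type w
  [ring : Ring carrier]
  [algebra : Algebra k carrier]
  act : B →ₗ[k] carrier →ₗ[k] carrier
  coact : carrier →ₐ[k] B ⊗[k] carrier
  isYD : IsYDll act coact

/-- Left-right `(H, Ĥ)`-Yetter-Drinfeld algebras. -/
structure YDlr (k : Type u) (H : Type v) [Field k] [Ring H] [HopfAlgebra k H]
    [FiniteDimensional k H] : Type (max u v (w + 1)) where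
  carrier : Type w
  [ring : Ring carrier]
  [algebra : Algebra k carrier]
  left : carrier →ₐ[k] H ⊗[k] carrier
  right : carrier →ₐ[k] carrier ⊗[k] DualHopf k H
  isYD : IsYDlr left right

attribute [instance] ComodAlg.ring ComodAlg.algebra ModAlg.ring ModAlg.algebra
  YDll.ring YDll.algebra YDlr.ring YDlr.algebra

section
variable {k : Type u} {B : Type v} [Field k] [Ring B] [Bialgebra k B]

/-- Algebra homomorphisms `f` with `(f ⊗ id) ρ = ρ' f`. -/
@[ext] structure ComodAlg.Hom (X Y : ComodAlg.{u, v, w} k B) where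
  toAlgHom : X.carrier →ₐ[k] Y.carrier
  comm : ∀ x, toAlgHom.toLinearMap.rTensor B (X.coact x) = Y.coact (toAlgHom x)

/-- Algebra homomorphisms `f` with `f (b ▷ x) = b ▷' f x`. -/
@[ext] structure ModAlg.Hom (X Y : ModAlg.{u, v, w} k B) where
  toAlgHom : X.carrier →ₐ[k] Y.carrier
  comm : ∀ b x, toAlgHom (X.act b x) = Y.act b (toAlgHom x)

/-- Algebra homomorphisms commuting with the actions and the coactions. -/
@[ext] structure YDll.Hom (X Y : YDll.{u, v, w} k B) where
  toAlgHom : X.carrier →ₐ[k] Y.carrier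
  comm_act : ∀ b x, toAlgHom (X.act b x) = Y.act b (toAlgHom x)
  comm_coact : ∀ x, toAlgHom.toLinearMap.lTensor B (X.coact x) = Y.coact (toAlgHom x)

instance : Category (ComodAlg.{u, v, w} k B) where
  Hom := ComodAlg.Hom
  id X := ⟨AlgHom.id k _, fun x => by simp⟩
  comp f g := ⟨g.toAlgHom.comp f.toAlgHom, fun x => by
    simp [LinearMap.rTensor_comp, f.comm, g.comm]⟩

instance : Category (ModAlg.{u, v, w} k B) where
  Hom := ModAlg.Hom
  id X := ⟨AlgHom.id k _, fun _ _ => rfl⟩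
  comp f g := ⟨g.toAlgHom.comp f.toAlgHom, fun b x => by simp [f.comm, g.comm]⟩

instance : Category (YDll.{u, v, w} k B) where
  Hom := YDll.Hom
  id X := ⟨AlgHom.id k _, fun _ _ => rfl, fun x => by simp⟩
  comp f g := ⟨g.toAlgHom.comp f.toAlgHom, fun b x => by simp [f.comm_act, g.comm_act],
    fun x => by simp [LinearMap.lTensor_comp, f.comm_coact, g.comm_coact]⟩

end

section
variable {k : Type u} {H : Type v} [Field k] [Ring H] [HopfAlgebra k H] [FiniteDimensional k H]

/-- Algebra homomorphisms commuting with both coactions. -/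
@[ext] structure YDlr.Hom (X Y : YDlr.{u, v, w} k H) where
  toAlgHom : X.carrier →ₐ[k] Y.carrier
  comm_left : ∀ x, toAlgHom.toLinearMap.lTensor H (X.left x) = Y.left (toAlgHom x)
  comm_right : ∀ x,
    toAlgHom.toLinearMap.rTensor (DualHopf k H) (X.right x) = Y.right (toAlgHom x)

instance : Category (YDlr.{u, v, w} k H) where
  Hom := YDlr.Hom
  id X := ⟨AlgHom.id k _, fun x => by simp, fun x => by simp⟩
  comp f g := ⟨g.toAlgHom.comp f.toAlgHom,
    fun x => by simp [LinearMap.lTensor_comp, f.comm_left, g.comm_left],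
    fun x => by simp [LinearMap.rTensor_comp, f.comm_right, g.comm_right]⟩

theorem codoubleCoaction_comm {X Y : YDlr.{u, v, w} k H} (f : X.Hom Y) (x : X.carrier) :
    f.toAlgHom.toLinearMap.rTensor (MajidCodouble k H) (codoubleCoaction X.left X.right x) =
      codoubleCoaction Y.left Y.right (f.toAlgHom x) := by
  simp only [codoubleCoaction, AlgHom.comp_apply, ← f.comm_right]
  induction X.right x with
  | zero => simp
  | add s t hs ht => simp only [map_add, hs, ht]
  | tmul y ω =>
    simp only [LinearMap.rTensor_tmul, Algebra.TensorProduct.map_tmul, AlgHom.comp_apply,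
      AlgHom.toLinearMap_apply, ← f.comm_left]
    induction X.left y with
    | zero => simp
    | add s t hs ht => simp only [map_add, TensorProduct.add_tmul, hs, ht]
    | tmul g z => simp

theorem dualAction_comm {X Y : YDlr.{u, v, w} k H} (f : X.Hom Y) (h : H) (x : X.carrier) :
    f.toAlgHom (dualAction X.right h x) = dualAction Y.right h (f.toAlgHom x) := by
  change f.toAlgHom.toLinearMap (evalRight _ h (X.right x)) = evalRight _ h (Y.right (f.toAlgHom x))
  rw [← f.comm_right, evalRight_map]

theorem doubleAction_comm {X Y : ComodAlg.{u, max u v, w} k (MajidCodouble k H)} (f : X.Hom Y)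
    (d : MajidDouble k H) (x : X.carrier) :
    f.toAlgHom (doubleAction X.coact d x) = doubleAction Y.coact d (f.toAlgHom x) := by
  change _ = TensorProduct.rid k Y.carrier
    ((MajidDouble.pairing k H d).lTensor Y.carrier (Y.coact (f.toAlgHom x)))
  rw [← f.comm]
  change f.toAlgHom (TensorProduct.rid k X.carrier
    ((MajidDouble.pairing k H d).lTensor X.carrier (X.coact x))) = _
  induction X.coact x with
  | zero => simp
  | add s t hs ht => simp only [map_add, hs, ht]
  | tmul y t => simp

theorem dualRightAction_comm {X Y : YDll.{u, v, w} k H} (f : X.Hom Y) (ω : DualHopf k H)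
    (x : X.carrier) :
    f.toAlgHom (dualRightAction X.coact ω x) = dualRightAction Y.coact ω (f.toAlgHom x) := by
  change f.toAlgHom (TensorProduct.lid k X.carrier
    (((pairing k H).flip ω).rTensor X.carrier (X.coact x))) = TensorProduct.lid k Y.carrier
    (((pairing k H).flip ω).rTensor Y.carrier (Y.coact (f.toAlgHom x)))
  rw [← f.comm_coact]
  induction X.coact x with
  | zero => simp
  | add s t hs ht => simp only [map_add, hs, ht]
  | tmul y t => simp

theorem majidAction_comm {X Y : YDll.{u, v, w} k H} (f : X.Hom Y) (d : MajidDouble k H)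
    (x : X.carrier) :
    f.toAlgHom (majidAction X.act X.coact d x) = majidAction Y.act Y.coact d (f.toAlgHom x) := by
  induction d using MajidDouble.induction with
  | zero => simp
  | add s t hs ht => simp only [map_add, LinearMap.add_apply, hs, ht]
  | tmul ω h =>
    change f.toAlgHom (dualRightAction X.coact ω (X.act h x)) =
      dualRightAction Y.coact ω (Y.act h (f.toAlgHom x))
    rw [dualRightAction_comm, f.comm_act]

/-- `(X, α, β) ↦ (X, γ = (Σ α ⊗ id) β)`. -/
def toComodAlg
    (h : ∀ X : YDlr.{u, v, w} k H, IsRightCoaction (codoubleCoaction X.left X.right)) :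
    YDlr.{u, v, w} k H ⥤ ComodAlg.{u, max u v, w} k (MajidCodouble k H) where
  obj X := ⟨X.carrier, codoubleCoaction X.left X.right, h X⟩
  map f := ⟨f.toAlgHom, codoubleCoaction_comm f⟩

/-- `(X, α, β) ↦ (X, ▷_β, α)`. -/
def toYDll (h : ∀ X : YDlr.{u, v, w} k H, IsYDll (dualAction X.right) X.left) :
    YDlr.{u, v, w} k H ⥤ YDll.{u, v, w} k H where
  obj X := ⟨X.carrier, dualAction X.right, X.left, h X⟩
  map f := ⟨f.toAlgHom, dualAction_comm f, f.comm_left⟩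

/-- `(X, γ) ↦ (X, ▷_γ)`. -/
def toModAlg (h : ∀ X : ComodAlg.{u, max u v, w} k (MajidCodouble k H),
      IsModuleAlgebra (doubleAction X.coact)) :
    ComodAlg.{u, max u v, w} k (MajidCodouble k H) ⥤ ModAlg.{u, max u v, w} k (MajidDouble k H) where
  obj X := ⟨X.carrier, doubleAction X.coact, h X⟩
  map f := ⟨f.toAlgHom, doubleAction_comm f⟩

/-- Majid's functor `(X, ▷, α) ↦ (X, ·)`. -/
def majidFunctor (h : ∀ X : YDll.{u, v, w} k H, IsModuleAlgebra (majidAction X.act X.coact)) :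
    YDll.{u, v, w} k H ⥤ ModAlg.{u, max u v, w} k (MajidDouble k H) where
  obj X := ⟨X.carrier, majidAction X.act X.coact, h X⟩
  map f := ⟨f.toAlgHom, majidAction_comm f⟩

end
end Categories

end

end YetterDrinfeld

open CategoryTheory YetterDrinfeld

universe u v w

/-! For finite-dimensional `C`, a perfect pairing of bialgebras `P : A → C*` identifies `X ⊗ C` with
`Hom(A, X)`. Under this identification an algebra map `ρ : X → X ⊗ C` is a coaction exactly when `a
▷ x = (id ⊗ P(a, ·))(ρ x)` makes `X` a module algebra. Every module algebra structure arises from a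
unique `ρ`, and equivariant maps are the same as colinear ones (`isRightCoaction_iff`,
`exists_coaction`, `hom_comm_coact`). Applied to `𝒟_M(H)` and `𝒯_M(H)` this is the equivalence (3);
applied to `H` and `Ĥ` it gives (2), once the two compatibility conditions are compared.

All compatibility conditions are compared in the convolution algebra `Hom(H, H ⊗ X)`. Fix `x` and
put `i(h) = h ⊗ 1`, `A(h) = (id ⊗ h ▷)(δ x)` and `B(h) = δ(h ▷ x)`. The map `i` is convolution
invertible, with inverse `h ↦ S(h) ⊗ 1`. The left-left condition says `i * A = B * i`. The
left-right condition, evaluated in its `Ĥ` leg, says `B = i * A * i⁻¹`, because pairing `U` and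
`U⁻¹` with `h` gives `h` and `S(h)`. The straightening rule of the double, which rewrites `(1 ⋈ h)(θ
⋈ 1)` in the form `∑ φ ⋈ c`, is respected by Majid's formula exactly when `A = i⁻¹ * B * i`. The
three equations are equivalent (`isYDlr_iff`, `majidAction_cross_iff`).

For (4), left coactions of `H` are right `Ĥ`-actions, hence left actions of `Ĥ^op`. The double is
spanned by products of elements of `Ĥ^op` and `H`, and its remaining relation is the straightening
rule. So a module algebra over it is a pair of such actions satisfying the Yetter-Drinfeld condition
(`majidAction_isModuleAlgebra`, `exists_isYDll`).

The square reduces to the identity `doubleAction_codoubleCoaction`, which needs no compatibility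
between `α` and `β`. The same identity shows that `γ` is a coaction, so its coassociativity is never
computed with the twisted coproduct. Finally (1) is an equivalence by two out of three. -/

namespace YetterDrinfeld

noncomputable section

set_option linter.unusedSectionVars false

/-! ### Perfect pairings of bialgebras: coactions of `C` as actions of its dual `A`. -/

section Pairing
universe v'
variable {k : Type u} {A : Type v} {C : Type v'} [Field k]

section Linear
variable [AddCommGroup A] [Module k A] [AddCommGroup C] [Module k C]

/-- `m ⊗ c ↦ P(a, c) m`. -/
def contract (P : A →ₗ[k] Module.Dual k C) (M : Type*) [AddCommMonoid M] [Module k M] (a : A) :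
    M ⊗[k] C →ₗ[k] M :=
  (TensorProduct.rid k M).toLinearMap ∘ₗ (P a).lTensor M

variable (P : A →ₗ[k] Module.Dual k C) {M N : Type*} [AddCommMonoid M] [Module k M]
  [AddCommMonoid N] [Module k N]

@[simp] theorem contract_tmul (a : A) (m : M) (c : C) : contract P M a (m ⊗ₜ c) = P a c • m := by
  simp [contract]

theorem contract_add (a b : A) (t : M ⊗[k] C) :
    contract P M (a + b) t = contract P M a t + contract P M b t := by
  simp [contract, LinearMap.lTensor_add]

theorem contract_smul (r : k) (a : A) (t : M ⊗[k] C) :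
    contract P M (r • a) t = r • contract P M a t := by
  simp [contract, LinearMap.lTensor_smul]

theorem contract_rTensor (f : M →ₗ[k] N) (a : A) (t : M ⊗[k] C) :
    contract P N a (f.rTensor C t) = f (contract P M a t) := by
  induction t with
  | zero => simp
  | add x y hx hy => simp only [map_add, hx, hy]
  | tmul m c => simp

variable {P}

/-- For a perfect pairing `P`, elements of `M ⊗ C` are the linear maps `A → M`. -/
theorem exists_contractEquiv [FiniteDimensional k C] (hP : Function.Bijective P) :
    ∃ e : M ⊗[k] C ≃ₗ[k] (A →ₗ[k] M), ∀ t a, e t a = contract P M a t := by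
  -- Finite dimension of `C` passes to `A`, so the flipped pairing is bijective too and `C` may be
  -- replaced by the dual of `A`.
  have : FiniteDimensional k A := Module.Finite.equiv (LinearEquiv.ofBijective P hP).symm
  have hperf : P.IsPerfPair := LinearMap.IsPerfPair.of_bijective P hP
  let q : C ≃ₗ[k] Module.Dual k A := LinearEquiv.ofBijective P.flip hperf.flip.1
  refine ⟨(TensorProduct.comm k M C).trans
    ((TensorProduct.congr q (LinearEquiv.refl k M)).trans (dualTensorHomEquiv k A M)), ?_⟩
  intro t a
  induction t with
  | zero => simp
  | add x y hx hy => simp only [map_add, LinearMap.add_apply, hx, hy]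
  | tmul m c => simp [q]

/-- The main way of proving identities between tensors: the functionals `P(a, ·)` separate the
elements of `M ⊗ C`. Since `M` is arbitrary, the test can be iterated to treat `X ⊗ C ⊗ C`. -/
theorem contract_ext [FiniteDimensional k C] (hP : Function.Bijective P) {s t : M ⊗[k] C}
    (h : ∀ a, contract P M a s = contract P M a t) : s = t := by
  obtain ⟨e, he⟩ := exists_contractEquiv (M := M) hP
  exact e.injective (LinearMap.ext fun a => by rw [he, he, h])

end Linear

variable [Ring A] [Bialgebra k A] [Ring C] [Bialgebra k C]

/-- A perfect pairing of bialgebras, identifying `A` with the dual of `C`. -/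
structure IsBialgebraPairing (P : A →ₗ[k] Module.Dual k C) : Prop where
  bijective : Function.Bijective P
  one_left : ∀ c, P 1 c = Coalgebra.counit (R := k) c
  mul_left : ∀ a b c, P (a * b) c =
    LinearMap.mul' k k (TensorProduct.map (P a) (P b) (Coalgebra.comul (R := k) c))
  one_right : ∀ a, P a 1 = Coalgebra.counit (R := k) a
  mul_right : ∀ a c d, P a (c * d) =
    LinearMap.mul' k k (TensorProduct.map (P.flip c) (P.flip d) (Coalgebra.comul (R := k) a))

variable {X Y : Type w} [Ring X] [Algebra k X] [Ring Y] [Algebra k Y]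

/-- `a ▷ x = (id ⊗ P(a, ·)) (ρ x)`. -/
def contractAction (P : A →ₗ[k] Module.Dual k C) (ρ : X →ₐ[k] X ⊗[k] C) : A →ₗ[k] X →ₗ[k] X :=
  LinearMap.mk₂ k (fun a x => contract P X a (ρ x))
    (fun a b x => contract_add P a b (ρ x)) (fun r a x => contract_smul P r a (ρ x))
    (by intros; simp) (by intros; simp)

theorem contractAction_apply (P : A →ₗ[k] Module.Dual k C) (ρ : X →ₐ[k] X ⊗[k] C) (a : A) (x : X) :
    contractAction P ρ a x = contract P X a (ρ x) := rfl

namespace IsBialgebraPairing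
variable {P : A →ₗ[k] Module.Dual k C} (hP : IsBialgebraPairing P)
include hP

theorem contract_one_left (t : X ⊗[k] C) : contract P X 1 t =
    TensorProduct.rid k X ((Coalgebra.counit (R := k)).lTensor X t) := by
  have : P 1 = Coalgebra.counit (R := k) := LinearMap.ext hP.one_left
  rw [contract, this]; rfl

theorem contract_one (a : A) : contract P X a (1 : X ⊗[k] C) =
    Coalgebra.counit (R := k) a • (1 : X) := by
  rw [Algebra.TensorProduct.one_def, contract_tmul, hP.one_right]

/-- The product of `C` is dual to the coproduct of `A`. This turns multiplicativity of `ρ` into the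
module algebra rule for products. -/
theorem contract_mul (a : A) (s t : X ⊗[k] C) :
    contract P X a (s * t) = ∑ i ∈ (Coalgebra.Repr.arbitrary k a).index,
      contract P X ((Coalgebra.Repr.arbitrary k a).left i) s *
        contract P X ((Coalgebra.Repr.arbitrary k a).right i) t := by
  induction s with
  | zero => simp
  | add x y hx hy => simp only [map_add, add_mul, hx, hy, Finset.sum_add_distrib]
  | tmul m c =>
    induction t with
    | zero => simp
    | add x y hx hy => simp only [map_add, mul_add, hx, hy, Finset.sum_add_distrib]
    | tmul n d =>
      rw [Algebra.TensorProduct.tmul_mul_tmul, contract_tmul, hP.mul_right,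
        ← (Coalgebra.Repr.arbitrary k a).eq]
      simp [Finset.sum_smul, smul_smul, mul_comm]

/-- The coproduct of `C` is dual to the product of `A`. The last leg is paired with `b` and the
inner one with `a`; this order is why right coactions correspond to left actions. -/
theorem contract_contract_comul (a b : A) (t : X ⊗[k] C) :
    contract P X a (contract P (X ⊗[k] C) b ((TensorProduct.assoc k X C C).symm
      ((Coalgebra.comul (R := k)).lTensor X t))) = contract P X (a * b) t := by
  induction t with
  | zero => simp
  | add x y hx hy => simp only [map_add, hx, hy]
  | tmul m c =>
    rw [contract_tmul, hP.mul_left, LinearMap.lTensor_tmul]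
    induction Coalgebra.comul (R := k) c with
    | zero => simp
    | add x y hx hy => simp only [map_add, TensorProduct.tmul_add, hx, hy, add_smul]
    | tmul x y => simp [smul_smul, mul_comm]

/-- Coactions of `C` are the actions of its dual `A`. -/
theorem isRightCoaction_iff [FiniteDimensional k C] (ρ : X →ₐ[k] X ⊗[k] C) :
    IsRightCoaction ρ ↔ IsModuleAlgebra (contractAction P ρ) := by
  -- Pairing the last leg with `b` commutes with applying `ρ` to the first, which leaves `ρ (b ▷ x)`
  -- to be paired with `a`.
  have assoc_rTensor : ∀ a b x, contract P X a (contract P (X ⊗[k] C) b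
      (ρ.toLinearMap.rTensor C (ρ x))) = contractAction P ρ a (contractAction P ρ b x) := by
    intro a b x
    rw [contract_rTensor]; rfl
  constructor
  -- Counit and coassociativity give the first two axioms; the last two only use that `ρ` is a
  -- unital algebra map.
  · intro h
    refine ⟨fun x => ?_, fun a b x => ?_, fun a => ?_, fun a x y => ?_⟩
    · rw [contractAction_apply, hP.contract_one_left, h.counit]
    · rw [contractAction_apply, ← hP.contract_contract_comul, ← h.coassoc,
        LinearEquiv.symm_apply_apply, assoc_rTensor]
    · rw [contractAction_apply, map_one, hP.contract_one]
    · rw [contractAction_apply, map_mul, hP.contract_mul]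
      conv_rhs => rw [← (Coalgebra.Repr.arbitrary k a).eq]
      simp [contractAction_apply]
  · intro h
    refine ⟨fun x => ?_, fun x => ?_⟩
    · apply (TensorProduct.assoc k X C C).symm.injective
      refine contract_ext hP.bijective fun b => contract_ext hP.bijective fun a => ?_
      rw [LinearEquiv.symm_apply_apply, assoc_rTensor, hP.contract_contract_comul, ← h.mul_act,
        contractAction_apply]
    · rw [← hP.contract_one_left, ← contractAction_apply, h.one_act]

/-- The tensor `ρ x` is the one representing the orbit map `a ↦ a ▷ x`. Only the algebra map is
built here; that it is a coaction then follows from `isRightCoaction_iff`. -/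
theorem exists_coaction [FiniteDimensional k C] {act : A →ₗ[k] X →ₗ[k] X}
    (h : IsModuleAlgebra act) : ∃ ρ : X →ₐ[k] X ⊗[k] C, contractAction P ρ = act := by
  obtain ⟨e, he⟩ := exists_contractEquiv (M := X) hP.bijective
  have hc : ∀ a x, contract P X a (e.symm (act.flip x)) = act a x := by
    intro a x
    rw [← he, LinearEquiv.apply_symm_apply]; rfl
  -- Unitality and multiplicativity of `ρ` are the axioms `act_one` and `act_mul`, tested against
  -- every `a`.
  refine ⟨AlgHom.ofLinearMap (e.symm.toLinearMap ∘ₗ act.flip) ?_ ?_, ?_⟩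
  · refine contract_ext hP.bijective fun a => ?_
    exact (hc a 1).trans ((h.act_one a).trans (hP.contract_one a).symm)
  · intro x y
    refine contract_ext hP.bijective fun a => ?_
    rw [hP.contract_mul]
    refine (hc a (x * y)).trans ((h.act_mul a x y).trans ?_)
    conv_lhs => rw [← (Coalgebra.Repr.arbitrary k a).eq]
    simp [hc]
  · ext a x
    exact hc a x

/-- This gives fullness of the functors from coactions to actions: nothing in the coaction is lost
by pairing it with all of `A`. -/
theorem hom_comm_coact [FiniteDimensional k C] {ρ : X →ₐ[k] X ⊗[k] C} {σ : Y →ₐ[k] Y ⊗[k] C}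
    (f : X →ₐ[k] Y)
    (h : ∀ a x, f (contractAction P ρ a x) = contractAction P σ a (f x)) (x : X) :
    f.toLinearMap.rTensor C (ρ x) = σ (f x) := by
  refine contract_ext hP.bijective fun a => ?_
  rw [contract_rTensor]
  exact h a x

end IsBialgebraPairing

end Pairing

/-! ### The two pairings in use: `H` with `Ĥ`, and the double with the codouble. -/

section Instances
variable {k : Type u} {H : Type v} [Field k] [Ring H] [HopfAlgebra k H] [FiniteDimensional k H]

theorem isBialgebraPairing_pairing : IsBialgebraPairing (A := H) (C := DualHopf k H)
    (pairing k H) where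
  bijective := by
    -- Perfectness is biduality of a finite-dimensional space.
    have h : (pairing k H : H →ₗ[k] Module.Dual k (DualHopf k H)) =
      (((Module.evalEquiv k H).trans (DualHopf.equiv k H).dualMap) :
        H →ₗ[k] Module.Dual k (DualHopf k H)) := rfl
    rw [h]
    exact LinearEquiv.bijective _
  one_left _ := rfl
  mul_left a b θ := by
    rw [← dual_comul_pairing]
    induction Coalgebra.comul (R := k) θ with
    | zero => simp
    | add x y hx hy => simp only [map_add, hx, hy]
    | tmul x y => simp
  one_right _ := rfl
  mul_right _ _ _ := rfl

/-- The four algebraic axioms say that `d ↦ 𝒫(d, ·)` is a map of bialgebras from the double to the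
dual of the codouble, which is already contained in the lemmas on `MajidDouble.toDual`. -/
theorem isBialgebraPairing_majidDouble :
    IsBialgebraPairing (MajidDouble.pairing k H) where
  bijective := by
    have hi : Function.Injective (MajidDouble.pairing k H) := fun d e h =>
      MajidDouble.toDual_injective (congrArg (DualHopf.equiv k (MajidCodouble k H)).symm h)
    have : FiniteDimensional k (MajidDouble k H) :=
      Module.Finite.equiv (MajidDouble.equiv k H).symm
    -- Surjectivity is a dimension count: `Ĥ ⊗ H` and `H ⊗ Ĥ` have the same dimension, and dualizing
    -- preserves it.
    refine ⟨hi, (LinearMap.injective_iff_surjective_of_finrank_eq_finrank ?_).1 hi⟩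
    rw [Subspace.dual_finrank_eq, (MajidDouble.equiv k H).finrank_eq,
      (MajidCodouble.equiv k H).toLinearEquiv.finrank_eq, Module.finrank_tensorProduct,
      Module.finrank_tensorProduct, mul_comm]
  one_left t := congr(YetterDrinfeld.pairing k (MajidCodouble k H) t
    $(MajidDouble.toDual_one (k := k) (H := H)))
  mul_left d e t := congr(YetterDrinfeld.pairing k (MajidCodouble k H) t
    $(MajidDouble.toDual_mul d e))
  one_right d := MajidDouble.counit_toDual d
  mul_right d s t := by
    have h := dual_comul_pairing (MajidDouble.toDual k H d) s t
    rw [← MajidDouble.toDual_comul] at h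
    refine h.symm.trans ?_
    induction Coalgebra.comul (R := k) d with
    | zero => simp
    | add x y hx hy => simp only [map_add, hx, hy]
    | tmul x y => simp; rfl

end Instances
-- The Yetter-Drinfeld conditions as equations in the convolution algebra `Hom(H, H ⊗ X)`.
section Convolution
variable {k : Type u} {H : Type v} {X : Type w} [Field k] [Ring H] [HopfAlgebra k H]
  [Ring X] [Algebra k X]

variable (k H X) in
/-- The map `h ↦ h ⊗ 1` as a unit of the convolution algebra, with inverse `h ↦ S(h) ⊗ 1`. -/
def convIncl : (WithConv (H →ₗ[k] H ⊗[k] X))ˣ where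
  val := WithConv.toConv (Algebra.TensorProduct.includeLeft : H →ₐ[k] H ⊗[k] X).toLinearMap
  inv := WithConv.toConv ((Algebra.TensorProduct.includeLeft : H →ₐ[k] H ⊗[k] X).toLinearMap ∘ₗ
    HopfAlgebra.antipode k)
  val_inv := by
    ext h
    rw [(Coalgebra.Repr.arbitrary k h).convMul_apply]
    simp [← TensorProduct.sum_tmul,
      HopfAlgebra.sum_mul_antipode_eq_algebraMap_counit (Coalgebra.Repr.arbitrary k h)]
  inv_val := by
    ext h
    rw [(Coalgebra.Repr.arbitrary k h).convMul_apply]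
    simp [← TensorProduct.sum_tmul,
      HopfAlgebra.sum_antipode_mul_eq_algebraMap_counit (Coalgebra.Repr.arbitrary k h)]

theorem convIncl_val_apply (h : H) : (convIncl k H X).val h = h ⊗ₜ 1 := rfl

theorem convIncl_inv_apply (h : H) :
    (convIncl k H X)⁻¹.val h = HopfAlgebra.antipode k h ⊗ₜ 1 := rfl

/-- `h ↦ δ (h ▷ x)`. -/
def coactAct (act : H →ₗ[k] X →ₗ[k] X) (δ : X →ₐ[k] H ⊗[k] X) (x : X) :
    WithConv (H →ₗ[k] H ⊗[k] X) :=
  WithConv.toConv (δ.toLinearMap ∘ₗ act.flip x)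

/-- `h ↦ (id ⊗ h ▷) (δ x)`. -/
def actCoact (act : H →ₗ[k] X →ₗ[k] X) (δ : X →ₐ[k] H ⊗[k] X) (x : X) :
    WithConv (H →ₗ[k] H ⊗[k] X) :=
  WithConv.toConv ((LinearMap.lTensorHom H).flip (δ x) ∘ₗ act)

variable (act : H →ₗ[k] X →ₗ[k] X) (δ : X →ₐ[k] H ⊗[k] X)

theorem coactAct_apply (x : X) (h : H) : coactAct act δ x h = δ (act h x) := rfl

theorem actCoact_apply (x : X) (h : H) : actCoact act δ x h = (act h).lTensor H (δ x) := rfl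

/-- The compatibility condition for `YDll` in the convolution algebra. -/
theorem compat_iff_conv (x : X) :
    (∀ h, TensorProduct.map (LinearMap.mul' k H) (TensorProduct.lift act)
        (TensorProduct.tensorTensorTensorComm k H H H X (Coalgebra.comul (R := k) h ⊗ₜ[k] δ x)) =
      LinearMap.mul' k (H ⊗[k] X) (TensorProduct.map (δ.toLinearMap ∘ₗ act.flip x)
        (Algebra.TensorProduct.includeLeft : H →ₐ[k] H ⊗[k] X).toLinearMap
        (Coalgebra.comul (R := k) h))) ↔
    (convIncl k H X).val * actCoact act δ x = coactAct act δ x * (convIncl k H X).val := by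
  have h1 : ∀ h, TensorProduct.map (LinearMap.mul' k H) (TensorProduct.lift act)
        (TensorProduct.tensorTensorTensorComm k H H H X (Coalgebra.comul (R := k) h ⊗ₜ[k] δ x)) =
      ((convIncl k H X).val * actCoact act δ x) h := by
    intro h
    rw [(Coalgebra.Repr.arbitrary k h).convMul_apply]
    conv_lhs => rw [← (Coalgebra.Repr.arbitrary k h).eq]
    simp only [TensorProduct.sum_tmul, map_sum, convIncl_val_apply, actCoact_apply]
    refine Finset.sum_congr rfl fun i _ => ?_
    induction δ x with
    | zero => simp
    | add s t hs ht => simp only [map_add, TensorProduct.tmul_add, mul_add, hs, ht]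
    | tmul s t => simp
  simp only [h1]
  exact ⟨fun h => WithConv.ext (LinearMap.ext h), fun h c => congr($h c)⟩

variable [FiniteDimensional k H]

/-- The compatibility condition for `YDlr` in the convolution algebra. -/
theorem compat_lr_iff_conv (β : X →ₐ[k] X ⊗[k] DualHopf k H) (x : X) :
    TensorProduct.assoc k H X (DualHopf k H) (δ.toLinearMap.rTensor (DualHopf k H) (β x)) =
      Ad (k := k) (Units.map
          ((legs13 : H ⊗[k] DualHopf k H →ₐ[k] H ⊗[k] (X ⊗[k] DualHopf k H)) : _ →* _)
          (canonicalUnit k H))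
        (β.toLinearMap.lTensor H (δ x)) ↔
    coactAct (dualAction β) δ x =
      (convIncl k H X).val * actCoact (dualAction β) δ x * (convIncl k H X)⁻¹.val := by
  -- After reassociation the `Ĥ` leg is the last one. Evaluating it at `h` turns products in `H ⊗ X
  -- ⊗ Ĥ` into convolution products, so each of the three factors of `Ad(U₁₃)(id ⊗ β)(δ x)` can be
  -- evaluated separately.
  let as := (Algebra.TensorProduct.assoc k k k H X (DualHopf k H)).symm
  have legs : ∀ (t : H ⊗[k] DualHopf k H) (h : H),
      evalRight (H ⊗[k] X) h (as (legs13 t)) = evalRight H h t ⊗ₜ 1 := by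
    intro t h
    induction t with
    | zero => simp
    | add s t hs ht => simp only [map_add, TensorProduct.add_tmul, hs, ht]
    | tmul s t => simp [as, legs13, TensorProduct.smul_tmul']
  have middle : ∀ (t : H ⊗[k] X) (h : H), evalRight (H ⊗[k] X) h
      (as (β.toLinearMap.lTensor H t)) = (dualAction β h).lTensor H t := by
    intro t h
    induction t with
    | zero => simp
    | add s t hs ht => simp only [map_add, hs, ht]
    | tmul s t =>
      change evalRight (H ⊗[k] X) h (as (s ⊗ₜ β t)) = s ⊗ₜ evalRight X h (β t)
      induction β t with
      | zero => simp
      | add x y hx hy => simp only [map_add, TensorProduct.tmul_add, hx, hy]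
      | tmul x y => simp [as]
  have right : ∀ h, evalRight (H ⊗[k] X) h (as (Ad (k := k) (Units.map
          ((legs13 : H ⊗[k] DualHopf k H →ₐ[k] H ⊗[k] (X ⊗[k] DualHopf k H)) : _ →* _)
          (canonicalUnit k H))
        (β.toLinearMap.lTensor H (δ x)))) =
      ((convIncl k H X).val * actCoact (dualAction β) δ x * (convIncl k H X)⁻¹.val) h := by
    intro h
    rw [(Coalgebra.Repr.arbitrary k h).convMul_apply, Ad_apply, map_mul as, map_mul as,
      evalRight_mul (Coalgebra.Repr.arbitrary k h)]
    refine Finset.sum_congr rfl fun i _ => ?_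
    rw [(Coalgebra.Repr.arbitrary k _).convMul_apply, evalRight_mul (Coalgebra.Repr.arbitrary k _)]
    congr 1
    · refine Finset.sum_congr rfl fun j _ => ?_
      rw [middle, actCoact_apply]
      refine congrArg (· * _) ((legs (canonicalElement k H) _).trans ?_)
      rw [evalRight_canonicalElement, convIncl_val_apply]
    -- The inverse of `U` is `(S ⊗ id)(U)`, whose evaluation at `h` is `S(h)`: this is the
    -- convolution inverse of the inclusion.
    · refine (legs ((HopfAlgebra.antipode k).rTensor (DualHopf k H) (canonicalElement k H))
        _).trans ?_
      rw [evalRight_map, evalRight_canonicalElement, convIncl_inv_apply]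
  have left : ∀ h, evalRight (H ⊗[k] X) h
      (as (TensorProduct.assoc k H X (DualHopf k H)
        (δ.toLinearMap.rTensor (DualHopf k H) (β x)))) = coactAct (dualAction β) δ x h := by
    intro h
    refine (congrArg (evalRight (H ⊗[k] X) h)
      ((TensorProduct.assoc k H X (DualHopf k H)).symm_apply_apply _)).trans ?_
    rw [evalRight_map]
    rfl
  constructor
  · intro h
    refine WithConv.ext (LinearMap.ext fun c => ?_)
    exact (left c).symm.trans ((congrArg (fun t => evalRight (H ⊗[k] X) c (as t)) h).trans (right c))
  · intro h
    apply as.injective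
    refine evalRight_ext fun c => ?_
    rw [left, right, h]

/-- With `▷` dual to `β`, the two compatibility conditions agree. -/
theorem isYDlr_iff (β : X →ₐ[k] X ⊗[k] DualHopf k H) :
    IsYDlr δ β ↔ IsYDll (dualAction β) δ := by
  -- The action in `e` is `contractAction` for the pairing of `H` with `Ĥ`, which agrees with
  -- `dualAction β` by definition.
  have e := (isBialgebraPairing_pairing (k := k) (H := H)).isRightCoaction_iff β
  -- Moving the invertible element `h ↦ h ⊗ 1` across the equation passes from one condition to the
  -- other.
  have conv : ∀ x, (coactAct (dualAction β) δ x =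
      (convIncl k H X).val * actCoact (dualAction β) δ x * (convIncl k H X)⁻¹.val) ↔
    (convIncl k H X).val * actCoact (dualAction β) δ x =
      coactAct (dualAction β) δ x * (convIncl k H X).val := fun x =>
    ((Units.eq_mul_inv_iff_mul_eq _).trans eq_comm)
  constructor
  · intro h
    exact ⟨e.1 h.right, h.left, fun c x => (compat_iff_conv _ δ x).2
      ((conv x).1 ((compat_lr_iff_conv δ β x).1 (h.compat x))) c⟩
  · intro h
    exact ⟨h.coaction, e.2 h.moduleAlgebra, fun x => (compat_lr_iff_conv δ β x).2
      ((conv x).2 ((compat_iff_conv _ δ x).1 (fun c => h.compat c x)))⟩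

end Convolution
-- Left coactions of `H` as right actions of `Ĥ`.
section DualEvaluation
variable {k : Type u} {H : Type v} [Field k] [Ring H] [HopfAlgebra k H] [FiniteDimensional k H]

/-- `h ⊗ m ↦ ω(h) m`. -/
def evalDual (M : Type*) [AddCommMonoid M] [Module k M] (ω : DualHopf k H) :
    H ⊗[k] M →ₗ[k] M :=
  (TensorProduct.lid k M).toLinearMap ∘ₗ ((pairing k H).flip ω).rTensor M

section
variable {M N : Type*} [AddCommMonoid M] [Module k M] [AddCommMonoid N] [Module k N]

@[simp] theorem evalDual_tmul (ω : DualHopf k H) (h : H) (m : M) :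
    evalDual M ω (h ⊗ₜ m) = pairing k H h ω • m := by
  simp [evalDual]

theorem evalDual_sum_smul {ι : Type*} (s : Finset ι) (c : ι → k) (φ : ι → DualHopf k H)
    (t : H ⊗[k] M) :
    evalDual M (∑ i ∈ s, c i • φ i) t = ∑ i ∈ s, c i • evalDual M (φ i) t := by
  induction t with
  | zero => simp
  | add x y hx hy => simp only [map_add, hx, hy, smul_add, Finset.sum_add_distrib]
  | tmul h m => simp [Finset.sum_smul, smul_smul]

theorem evalDual_eq_contract (ω : DualHopf k H) (t : H ⊗[k] M) : evalDual M ω t =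
    contract (DualHopf.equiv k H).toLinearMap M ω (TensorProduct.comm k H M t) := by
  induction t with
  | zero => simp
  | add x y hx hy => simp only [map_add, hx, hy]
  | tmul h m => simp [equiv_apply]

/-- Flipping the factors reduces this to the linear theory of perfect pairings. The bialgebra part
is not transported in this way: the flip of a left `H`-coaction is a right coaction of `H^co`, not
of `H`. -/
theorem evalDual_ext {s t : H ⊗[k] M} (h : ∀ ω, evalDual M ω s = evalDual M ω t) : s = t := by
  apply (TensorProduct.comm k H M).injective
  refine contract_ext (P := (DualHopf.equiv k H).toLinearMap) (DualHopf.equiv k H).bijective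
    fun ω => ?_
  rw [← evalDual_eq_contract, ← evalDual_eq_contract, h]

theorem evalDual_surjective (f : DualHopf k H →ₗ[k] M) :
    ∃ t : H ⊗[k] M, ∀ ω, evalDual M ω t = f ω := by
  obtain ⟨e, he⟩ := exists_contractEquiv (M := M) (P := (DualHopf.equiv k H).toLinearMap)
    (DualHopf.equiv k H).bijective
  refine ⟨(TensorProduct.comm k H M).symm (e.symm f), fun ω => ?_⟩
  rw [evalDual_eq_contract, LinearEquiv.apply_symm_apply, ← he, LinearEquiv.apply_symm_apply]

theorem evalDual_lTensor (f : M →ₗ[k] N) (ω : DualHopf k H) (t : H ⊗[k] M) :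
    evalDual N ω (f.lTensor H t) = f (evalDual M ω t) := by
  induction t with
  | zero => simp
  | add x y hx hy => simp only [map_add, hx, hy]
  | tmul m c => simp

/-- Here `θ` is paired with the first leg and `ω` with the second, so for a coaction `θ * ω` means
acting with `θ` before `ω`. This is the source of the right action and of the opposite algebra in
the double. -/
theorem evalDual_evalDual_comul (ω θ : DualHopf k H) (t : H ⊗[k] M) :
    evalDual M ω (evalDual (H ⊗[k] M) θ (TensorProduct.assoc k H H M
      ((Coalgebra.comul (R := k)).rTensor M t))) = evalDual M (θ * ω) t := by
  induction t with
  | zero => simp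
  | add x y hx hy => simp only [map_add, hx, hy]
  | tmul h m =>
    rw [evalDual_tmul, pairing_mul (Coalgebra.Repr.arbitrary k h), LinearMap.rTensor_tmul,
      ← (Coalgebra.Repr.arbitrary k h).eq]
    simp [TensorProduct.sum_tmul, Finset.sum_smul, smul_smul]

theorem evalDual_one (t : H ⊗[k] M) : evalDual M 1 t =
    TensorProduct.lid k M ((Coalgebra.counit (R := k)).rTensor M t) := rfl

end

section
variable {X : Type w} [Ring X] [Algebra k X]

theorem evalDual_algebra_one (ω : DualHopf k H) : evalDual X ω 1 =
    Coalgebra.counit (R := k) ω • (1 : X) := by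
  rw [Algebra.TensorProduct.one_def, evalDual_tmul, dual_counit]

theorem evalDual_algebra_mul (ω : DualHopf k H) (s t : H ⊗[k] X) : evalDual X ω (s * t) =
    ∑ i ∈ (Coalgebra.Repr.arbitrary k ω).index,
      evalDual X ((Coalgebra.Repr.arbitrary k ω).left i) s *
        evalDual X ((Coalgebra.Repr.arbitrary k ω).right i) t := by
  induction s with
  | zero => simp
  | add x y hx hy => simp only [map_add, add_mul, hx, hy, Finset.sum_add_distrib]
  | tmul a m =>
    induction t with
    | zero => simp
    | add x y hx hy => simp only [map_add, mul_add, hx, hy, Finset.sum_add_distrib]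
    | tmul b n =>
      rw [Algebra.TensorProduct.tmul_mul_tmul, evalDual_tmul, ← dual_comul_pairing,
        ← (Coalgebra.Repr.arbitrary k ω).eq]
      simp [Finset.sum_smul, smul_smul, mul_comm]

/-- By definition `(b ▶ ω)(a) = ω(ab)`. Together with its left-handed counterpart
`evalDual_evalLeft_comul`, this turns the coregular actions in the straightening map into
multiplications in `H ⊗ X`. -/
theorem evalDual_leftCoregular (b : H) (ω : DualHopf k H) (s : H ⊗[k] X) :
    evalDual X (leftCoregular k H b ω) s = evalDual X ω (s * (b ⊗ₜ 1)) := by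
  induction s with
  | zero => simp
  | add x y hx hy => simp only [map_add, add_mul, hx, hy]
  | tmul a m => simp [pairing_evalRight_comul]

theorem evalDual_evalLeft_comul (a : H) (ω : DualHopf k H) (s : H ⊗[k] X) :
    evalDual X (evalLeft _ a (Coalgebra.comul (R := k) ω)) s = evalDual X ω ((a ⊗ₜ 1) * s) := by
  induction s with
  | zero => simp
  | add x y hx hy => simp only [map_add, mul_add, hx, hy]
  | tmul b m => simp [dual_comul_pairing]

theorem dualRightAction_apply (δ : X →ₐ[k] H ⊗[k] X) (ω : DualHopf k H) (x : X) :
    dualRightAction δ ω x = evalDual X ω (δ x) := rfl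

/-- A right action of the dual algebra, compatible with the product of `X`. -/
structure IsDualModuleAlgebra (ract : DualHopf k H →ₗ[k] X →ₗ[k] X) : Prop where
  one_act : ∀ x, ract 1 x = x
  mul_act : ∀ θ ω x, ract (θ * ω) x = ract ω (ract θ x)
  act_one : ∀ ω, ract ω 1 = Coalgebra.counit (R := k) ω • (1 : X)
  act_mul : ∀ ω x y, ract ω (x * y) = LinearMap.mul' k X
    (TensorProduct.map (ract.flip x) (ract.flip y) (Coalgebra.comul (R := k) ω))

/-- Left coactions of `H` are the right actions of its dual. -/
theorem isLeftCoaction_iff (δ : X →ₐ[k] H ⊗[k] X) :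
    IsLeftCoaction δ ↔ IsDualModuleAlgebra (dualRightAction δ) := by
  -- The outer leg is paired with `θ` and commutes with applying `δ` to the other leg, so `θ` acts
  -- first.
  have lTensor : ∀ ω θ x, evalDual X ω (evalDual (H ⊗[k] X) θ (δ.toLinearMap.lTensor H (δ x))) =
      dualRightAction δ ω (dualRightAction δ θ x) := by
    intro ω θ x
    rw [evalDual_lTensor]; rfl
  constructor
  · intro h
    refine ⟨fun x => ?_, fun θ ω x => ?_, fun ω => ?_, fun ω x y => ?_⟩
    · rw [dualRightAction_apply, evalDual_one, h.counit]
    · rw [dualRightAction_apply, ← evalDual_evalDual_comul, ← h.coassoc, lTensor]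
    · rw [dualRightAction_apply, map_one, evalDual_algebra_one]
    · rw [dualRightAction_apply, map_mul, evalDual_algebra_mul]
      conv_rhs => rw [← (Coalgebra.Repr.arbitrary k ω).eq]
      simp [dualRightAction_apply]
  · intro h
    refine ⟨fun x => ?_, fun x => ?_⟩
    · refine evalDual_ext fun θ => evalDual_ext fun ω => ?_
      rw [lTensor, evalDual_evalDual_comul, ← h.mul_act, dualRightAction_apply]
    · rw [← evalDual_one, ← dualRightAction_apply, h.one_act]

theorem IsDualModuleAlgebra.exists_coaction {ract : DualHopf k H →ₗ[k] X →ₗ[k] X}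
    (h : IsDualModuleAlgebra ract) : ∃ δ : X →ₐ[k] H ⊗[k] X, dualRightAction δ = ract := by
  -- The element `d x` is determined by the functional `ω ↦ x ◁ ω`, so linearity of `d`, and then
  -- unitality and multiplicativity, can be tested by evaluation.
  choose d hd using fun x => evalDual_surjective (ract.flip x)
  have hd' : ∀ x ω, evalDual X ω (d x) = ract ω x := hd
  let D : X →ₗ[k] H ⊗[k] X :=
    { toFun := d
      map_add' := fun x y => evalDual_ext fun ω => by simp [hd']
      map_smul' := fun c x => evalDual_ext fun ω => by simp [hd'] }
  refine ⟨AlgHom.ofLinearMap D ?_ ?_, ?_⟩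
  · refine evalDual_ext fun ω => ?_
    exact (hd' 1 ω).trans ((h.act_one ω).trans (evalDual_algebra_one ω).symm)
  · intro x y
    refine evalDual_ext fun ω => ?_
    rw [evalDual_algebra_mul]
    refine (hd' (x * y) ω).trans ((h.act_mul ω x y).trans ?_)
    conv_lhs => rw [← (Coalgebra.Repr.arbitrary k ω).eq]
    simp [D, hd']
  · ext ω x
    exact hd' x ω

end
end DualEvaluation

/-! ### The straightening map `𝔗` and its action on `X`. -/

section Straighten
variable {k : Type u} {H : Type v} [Field k] [Ring H] [HopfAlgebra k H] [FiniteDimensional k H]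

theorem straighten_eq {ι κ : Type*} {h : H} {θ : DualHopf k H} (r : Coalgebra.Repr k h ι)
    (q : Coalgebra.Repr k θ κ) : straighten k H (h ⊗ₜ θ) =
      ∑ i ∈ r.index, ∑ m ∈ q.index, leftCoregular k H (r.right i) (q.right m) ⊗ₜ
        rightCoregular k H (r.left i) (HopfAlgebra.antipode k (q.left m)) := by
  simp only [straighten, LinearMap.comp_apply, TensorProduct.map_tmul, ← r.eq, ← q.eq,
    TensorProduct.sum_tmul, TensorProduct.tmul_sum, map_sum]
  rw [Finset.sum_comm]
  simp

/-- Both coregular formulas degenerate: `h₂ ▶ 1 = ε(h₂) 1` and `h₁ ◀ 1 = h₁`, and the counit axiom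
collapses the sum. With its companion for `1 ⊗ θ`, this embeds the two factors in the double. -/
theorem straighten_tmul_one (h : H) : straighten k H (h ⊗ₜ 1) = 1 ⊗ₜ h := by
  -- A one-term representation of `Δ(1) = 1 ⊗ 1`, chosen so that the sum over `q` disappears.
  let q : Coalgebra.Repr k (1 : DualHopf k H) Unit :=
    ⟨{()}, fun _ => 1, fun _ => 1, by simp [Algebra.TensorProduct.one_def]⟩
  have e : ∀ c : H, rightCoregular k H c 1 = c := by
    intro c
    rw [rightCoregular_apply (Coalgebra.Repr.arbitrary k c)]
    exact Coalgebra.sum_counit_smul _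
  rw [straighten_eq (Coalgebra.Repr.arbitrary k h) q]
  simp only [q, Finset.sum_singleton, HopfAlgebra.antipode_one, e, leftCoregular_apply,
    Bialgebra.comul_one, evalRight_one]
  simp only [TensorProduct.smul_tmul, ← TensorProduct.tmul_sum]
  have h5 := congr(TensorProduct.rid k H
    $(Coalgebra.sum_tmul_counit_eq (Coalgebra.Repr.arbitrary k h)))
  simp only [map_sum, TensorProduct.rid_tmul, one_smul] at h5
  rw [h5]

theorem straighten_one_tmul (θ : DualHopf k H) : straighten k H (1 ⊗ₜ θ) = θ ⊗ₜ 1 := by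
  let r : Coalgebra.Repr k (1 : H) Unit :=
    ⟨{()}, fun _ => 1, fun _ => 1, by simp [Algebra.TensorProduct.one_def]⟩
  rw [straighten_eq r (Coalgebra.Repr.arbitrary k θ)]
  have e : ∀ φ : DualHopf k H, rightCoregular k H 1 φ = Coalgebra.counit (R := k) φ • 1 := by
    intro φ
    rw [rightCoregular_apply r]
    simp [r]
  have e' : ∀ φ : DualHopf k H, leftCoregular k H 1 φ = φ := by
    intro φ
    refine DualHopf.ext_pairing fun b => ?_
    rw [leftCoregular_apply, pairing_evalRight_comul, mul_one]
  simp only [r, Finset.sum_singleton, e, e', HopfAlgebra.counit_antipode]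
  simp only [← TensorProduct.smul_tmul, ← TensorProduct.sum_tmul, Coalgebra.sum_counit_smul]

variable {X : Type w} [Ring X] [Algebra k X]

/-- The straightened product acts as `θ ⊗ id` of a convolution conjugate. -/
theorem majidAction_straighten (act : H →ₗ[k] X →ₗ[k] X) (δ : X →ₐ[k] H ⊗[k] X) (h : H)
    (θ : DualHopf k H) (x : X) :
    majidAction act δ ((MajidDouble.equiv k H).symm (straighten k H (h ⊗ₜ θ))) x =
      evalDual X θ (((convIncl k H X)⁻¹.val * coactAct act δ x * (convIncl k H X).val) h) := by
  let r := Coalgebra.Repr.arbitrary k h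
  let q := Coalgebra.Repr.arbitrary k θ
  have act_tmul : ∀ ω c, majidAction act δ ((MajidDouble.equiv k H).symm (ω ⊗ₜ c)) x =
      evalDual X ω (δ (act c x)) := fun _ _ => rfl
  rw [r.convMul_apply, straighten_eq r q]
  simp only [map_sum, LinearMap.sum_apply, act_tmul]
  refine Finset.sum_congr rfl fun i _ => ?_
  rw [(Coalgebra.Repr.arbitrary k (r.left i)).convMul_apply, Finset.sum_mul, map_sum]
  simp only [rightCoregular_apply (Coalgebra.Repr.arbitrary k (r.left i)), map_sum,
    LinearMap.sum_apply, map_smul, LinearMap.smul_apply]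
  rw [Finset.sum_comm]
  refine Finset.sum_congr rfl fun j _ => ?_
  -- In Sweedler notation the term is `θ₁(S(h₁))` times the value of `h₃ ▶ θ₂` on `δ(h₂ ▷ x)`. The
  -- coregular action becomes right multiplication by `h₃ ⊗ 1`, and splitting `θ` becomes left
  -- multiplication by `S(h₁) ⊗ 1`.
  rw [convIncl_inv_apply, convIncl_val_apply, coactAct_apply, mul_assoc, ← evalDual_evalLeft_comul,
    ← q.eq]
  simp only [evalDual_leftCoregular, pairing_antipode, map_sum, evalLeft_tmul, evalDual_sum_smul]

end Straighten
-- Majid's action: module algebras over the double and Yetter-Drinfeld algebras.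
section Majid
variable {k : Type u} {H : Type v} {X : Type w} [Field k] [Ring H] [HopfAlgebra k H]
  [FiniteDimensional k H] [Ring X] [Algebra k X]

theorem majidAction_tmul (act : H →ₗ[k] X →ₗ[k] X) (δ : X →ₐ[k] H ⊗[k] X) (ω : DualHopf k H)
    (h : H) (x : X) : majidAction act δ ((MajidDouble.equiv k H).symm (ω ⊗ₜ h)) x =
      dualRightAction δ ω (act h x) := rfl

theorem majidDouble_mul (ω θ : DualHopf k H) (h g : H) :
    (MajidDouble.equiv k H).symm (ω ⊗ₜ h) * (MajidDouble.equiv k H).symm (θ ⊗ₜ g) =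
      (MajidDouble.equiv k H).symm (TensorProduct.map (LinearMap.mulRight k ω)
        (LinearMap.mulRight k g) (straighten k H (h ⊗ₜ θ))) :=
  congrArg (MajidDouble.equiv k H).symm (doubleMul_tmul ω θ h g)

/-- The straightened element acts through the conjugate by `h ↦ h ⊗ 1` of `h ↦ δ(h ▷ x)`, while
acting with `θ` and then `h` gives `h ↦ (id ⊗ h ▷)(δ x)`. Since `θ` is arbitrary, the cross relation
of the double is the Yetter-Drinfeld condition. Both directions are used: one to construct the
action, the other to recover the condition. -/
theorem majidAction_cross_iff (act : H →ₗ[k] X →ₗ[k] X) (δ : X →ₐ[k] H ⊗[k] X) (x : X) :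
    (∀ h θ, majidAction act δ ((MajidDouble.equiv k H).symm (straighten k H (h ⊗ₜ θ))) x =
      act h (dualRightAction δ θ x)) ↔
    (convIncl k H X).val * actCoact act δ x = coactAct act δ x * (convIncl k H X).val := by
  have e : (convIncl k H X).val * actCoact act δ x = coactAct act δ x * (convIncl k H X).val ↔
      actCoact act δ x = (convIncl k H X)⁻¹.val * coactAct act δ x * (convIncl k H X).val := by
    rw [mul_assoc]
    exact (Units.eq_inv_mul_iff_mul_eq _).symm
  rw [e]
  have g : ∀ h θ, act h (dualRightAction δ θ x) = evalDual X θ (actCoact act δ x h) := by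
    intro h θ
    rw [actCoact_apply, evalDual_lTensor]; rfl
  simp only [majidAction_straighten, g]
  constructor
  · intro h
    exact WithConv.ext (LinearMap.ext fun c => evalDual_ext fun θ => (h c θ).symm)
  · intro h c θ
    rw [← h]

/-- Only associativity of the action involves the twisted product, and there the cross relation is
used. The other axioms combine the `H`-action and the `Ĥ`-action, since the coalgebra of the double
is the tensor product. -/
theorem majidAction_isModuleAlgebra {act : H →ₗ[k] X →ₗ[k] X} {δ : X →ₐ[k] H ⊗[k] X}
    (h : IsYDll act δ) : IsModuleAlgebra (majidAction act δ) := by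
  have hm := h.moduleAlgebra
  have hd := (isLeftCoaction_iff δ).1 h.coaction
  refine ⟨fun x => ?_, fun d e x => ?_, fun d => ?_, fun d x y => ?_⟩
  · refine (majidAction_tmul act δ 1 1 x).trans ?_
    rw [hm.one_act, hd.one_act]
  · induction d using MajidDouble.induction with
    | zero => simp
    | add s t hs ht => simp only [map_add, add_mul, LinearMap.add_apply, hs, ht]
    | tmul ω a =>
      induction e using MajidDouble.induction with
      | zero => simp
      | add s t hs ht => simp only [map_add, mul_add, LinearMap.add_apply, hs, ht]
      | tmul θ b =>
        -- The cross relation is applied to `b ▷ x` rather than to `x`. Each term `φ ⊗ c` of the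
        -- straightened element then contributes the action of `φ ω ⋈ c b`, with `ω` outermost and
        -- `b` innermost.
        rw [majidDouble_mul, majidAction_tmul, majidAction_tmul,
          ← (majidAction_cross_iff act δ (act b x)).2
            ((compat_iff_conv act δ _).1 fun c => h.compat c _) a θ]
        induction straighten k H (a ⊗ₜ θ) with
        | zero => simp
        | add s t hs ht => simp only [map_add, LinearMap.add_apply, hs, ht]
        | tmul φ c =>
          rw [TensorProduct.map_tmul, majidAction_tmul, majidAction_tmul, LinearMap.mulRight_apply,
            LinearMap.mulRight_apply, hm.mul_act, hd.mul_act]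
  · induction d using MajidDouble.induction with
    | zero => simp
    | add s t hs ht => simp only [map_add, LinearMap.add_apply, hs, ht, add_smul]
    | tmul ω a =>
      rw [majidAction_tmul, hm.act_one, map_smul, hd.act_one, smul_smul]
      rfl
  · induction d using MajidDouble.induction with
    | zero => simp
    | add s t hs ht => simp only [map_add, LinearMap.add_apply, hs, ht]
    | tmul ω a =>
      -- The identification with `Ĥ ⊗ H` is the identity map, so this is the tensor product
      -- coproduct with an identity inserted.
      have hc : Coalgebra.comul (R := k) ((MajidDouble.equiv k H).symm (ω ⊗ₜ a)) =
        TensorProduct.map (MajidDouble.equiv k H).symm.toLinearMap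
          (MajidDouble.equiv k H).symm.toLinearMap (TensorProduct.tensorTensorTensorComm k _ _ _ _
            (Coalgebra.comul (R := k) ω ⊗ₜ Coalgebra.comul (R := k) a)) := by
        refine Eq.trans ?_ congr($(TensorProduct.map_id.symm) _)
        rfl
      rw [majidAction_tmul, hm.act_mul, hc]
      induction Coalgebra.comul (R := k) a with
      | zero => simp
      | add s t hs ht => simp only [map_add, TensorProduct.tmul_add, hs, ht]
      | tmul b c =>
        rw [TensorProduct.map_tmul, LinearMap.mul'_apply, hd.act_mul]
        induction Coalgebra.comul (R := k) ω with
        | zero => simp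
        | add s t hs ht => simp only [map_add, TensorProduct.add_tmul, hs, ht]
        | tmul θ φ => simp [majidAction_tmul]

/-! ### The factors `H` and `Ĥ^op` inside the double. -/

variable (k H) in
/-- `h ↦ 1 ⋈ h`. -/
def MajidDouble.inclRight : H →ₗ[k] MajidDouble k H :=
  (MajidDouble.equiv k H).symm.toLinearMap ∘ₗ TensorProduct.mk k _ _ 1

variable (k H) in
/-- `ω ↦ ω ⋈ 1`. -/
def MajidDouble.inclLeft : DualHopf k H →ₗ[k] MajidDouble k H :=
  (MajidDouble.equiv k H).symm.toLinearMap ∘ₗ (TensorProduct.mk k _ _).flip 1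

namespace MajidDouble

theorem inclRight_mul (h g : H) : inclRight k H (h * g) = inclRight k H h * inclRight k H g := by
  refine Eq.trans ?_ (majidDouble_mul 1 1 h g).symm
  rw [straighten_tmul_one]
  simp [inclRight]

/-- The order reverses because the factor is `Ĥ^op`; a left module over the double therefore
restricts to a right `Ĥ`-module. -/
theorem inclLeft_mul (θ ω : DualHopf k H) :
    inclLeft k H (θ * ω) = inclLeft k H ω * inclLeft k H θ := by
  refine Eq.trans ?_ (majidDouble_mul ω θ 1 1).symm
  rw [straighten_one_tmul]
  simp [inclLeft]

/-- Products in this order must be straightened, whereas in the opposite order they are the pure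
tensors (`inclLeft_mul_inclRight`). These two rules translate a module over the double into its two
restrictions and the cross relation. -/
theorem inclRight_mul_inclLeft (h : H) (θ : DualHopf k H) : inclRight k H h * inclLeft k H θ =
    (MajidDouble.equiv k H).symm (straighten k H (h ⊗ₜ θ)) := by
  refine (majidDouble_mul 1 θ h 1).trans ?_
  simp

theorem inclLeft_mul_inclRight (ω : DualHopf k H) (h : H) : inclLeft k H ω * inclRight k H h =
    (MajidDouble.equiv k H).symm (ω ⊗ₜ h) := by
  refine (majidDouble_mul ω 1 1 h).trans ?_
  rw [straighten_one_tmul]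
  simp

theorem counit_inclRight (h : H) :
    Coalgebra.counit (R := k) (inclRight k H h) = Coalgebra.counit (R := k) h := by
  refine (TensorProduct.counit_tmul (R := k) (S := k) (1 : DualHopf k H) h).trans ?_
  simp

theorem counit_inclLeft (ω : DualHopf k H) :
    Coalgebra.counit (R := k) (inclLeft k H ω) = Coalgebra.counit (R := k) ω := by
  refine (TensorProduct.counit_tmul (R := k) (S := k) ω (1 : H)).trans ?_
  simp

theorem comul_inclRight (h : H) : Coalgebra.comul (R := k) (inclRight k H h) =
    TensorProduct.map (inclRight k H) (inclRight k H) (Coalgebra.comul (R := k) h) := by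
  refine (TensorProduct.comul_tmul (R := k) (S := k) (1 : DualHopf k H) h).trans ?_
  rw [Bialgebra.comul_one]
  induction Coalgebra.comul (R := k) h with
  | zero => simp; rfl
  | add s t hs ht => rw [TensorProduct.tmul_add, map_add, map_add, ← hs, ← ht]; rfl
  | tmul s t => rfl

theorem comul_inclLeft (ω : DualHopf k H) : Coalgebra.comul (R := k) (inclLeft k H ω) =
    TensorProduct.map (inclLeft k H) (inclLeft k H) (Coalgebra.comul (R := k) ω) := by
  refine (TensorProduct.comul_tmul (R := k) (S := k) ω (1 : H)).trans ?_
  rw [Bialgebra.comul_one]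
  induction Coalgebra.comul (R := k) ω with
  | zero => simp; rfl
  | add s t hs ht => rw [TensorProduct.add_tmul, map_add, map_add, ← hs, ← ht]; rfl
  | tmul s t => rfl

end MajidDouble

open MajidDouble

/-- The unit of `Ĥ` is the counit of `H`, so it acts trivially by counitality of `δ`. Restriction to
the two factors thus recovers both Yetter-Drinfeld structures. -/
theorem majidAction_inclRight {act : H →ₗ[k] X →ₗ[k] X} {δ : X →ₐ[k] H ⊗[k] X}
    (h : IsYDll act δ) (a : H) (x : X) : majidAction act δ (inclRight k H a) x = act a x :=
  (majidAction_tmul act δ 1 a x).trans (((isLeftCoaction_iff δ).1 h.coaction).one_act _)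

theorem majidAction_inclLeft {act : H →ₗ[k] X →ₗ[k] X} {δ : X →ₐ[k] H ⊗[k] X}
    (h : IsYDll act δ) (ω : DualHopf k H) (x : X) :
    majidAction act δ (inclLeft k H ω) x = dualRightAction δ ω x :=
  (majidAction_tmul act δ ω 1 x).trans (by rw [h.moduleAlgebra.one_act])

/-- Every module algebra over the double comes from a Yetter-Drinfeld algebra. -/
theorem exists_isYDll {a : MajidDouble k H →ₗ[k] X →ₗ[k] X} (h : IsModuleAlgebra a) :
    ∃ (act : H →ₗ[k] X →ₗ[k] X) (δ : X →ₐ[k] H ⊗[k] X), IsYDll act δ ∧ majidAction act δ = a := by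
  -- The candidates are the restrictions of `a` to the two factors; `δ` is then the left coaction
  -- that represents the restriction to `Ĥ^op`.
  let act := a ∘ₗ inclRight k H
  let ract := a ∘ₗ inclLeft k H
  have hm : IsModuleAlgebra act := by
    refine ⟨h.one_act, fun b c x => ?_, fun b => ?_, fun b x y => ?_⟩
    · simp only [act, LinearMap.comp_apply, inclRight_mul, h.mul_act]
    · simp only [act, LinearMap.comp_apply, h.act_one, counit_inclRight]
    · simp only [act, LinearMap.comp_apply, h.act_mul, comul_inclRight]
      induction Coalgebra.comul (R := k) b with
      | zero => simp
      | add s t hs ht => simp only [map_add, hs, ht]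
      | tmul s t => rfl
  have hr : IsDualModuleAlgebra ract := by
    refine ⟨h.one_act, fun b c x => ?_, fun b => ?_, fun b x y => ?_⟩
    · simp only [ract, LinearMap.comp_apply, inclLeft_mul, h.mul_act]
    · simp only [ract, LinearMap.comp_apply, h.act_one, counit_inclLeft]
    · simp only [ract, LinearMap.comp_apply, h.act_mul, comul_inclLeft]
      induction Coalgebra.comul (R := k) b with
      | zero => simp
      | add s t hs ht => simp only [map_add, hs, ht]
      | tmul s t => rfl
  obtain ⟨δ, hδ⟩ := hr.exists_coaction
  have ha : majidAction act δ = a := by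
    ext d x
    induction d using MajidDouble.induction with
    | zero => simp
    | add s t hs ht => simp only [map_add, LinearMap.add_apply, hs, ht]
    | tmul ω c =>
      rw [majidAction_tmul, hδ, ← inclLeft_mul_inclRight, h.mul_act]
      rfl
  refine ⟨act, δ, ⟨hm, (isLeftCoaction_iff δ).2 (hδ ▸ hr), fun c x => ?_⟩, ha⟩
  -- The cross relation holds in the double and `a` is an action, so compatibility needs no further
  -- computation.
  refine (compat_iff_conv act δ x).2 ((majidAction_cross_iff act δ x).1 fun b θ => ?_) c
  rw [ha, hδ, ← inclRight_mul_inclLeft, h.mul_act]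
  rfl

/-- The action of the double on a left-right Yetter-Drinfeld algebra. -/
theorem doubleAction_codoubleCoaction (α : X →ₐ[k] H ⊗[k] X) (β : X →ₐ[k] X ⊗[k] DualHopf k H) :
    doubleAction (codoubleCoaction α β) = majidAction (dualAction β) α := by
  ext d x
  induction d using MajidDouble.induction with
  | zero => simp
  | add s t hs ht => simp only [map_add, LinearMap.add_apply, hs, ht]
  | tmul ω h =>
    -- As `𝒫(ω ⋈ h, g ⊗ θ) = ω(g) θ(h)`, both sides evaluate the `Ĥ` leg of `β x` at `h` and the `H`
    -- leg of `α` at `ω`.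
    change TensorProduct.rid k X ((MajidDouble.pairing k H _).lTensor X
      (Algebra.TensorProduct.map (AlgHom.id k X) (MajidCodouble.equiv k H).symm.toAlgHom
        (Algebra.TensorProduct.assoc k k k X H (DualHopf k H)
          (Algebra.TensorProduct.map ((Algebra.TensorProduct.comm k H X).toAlgHom.comp α)
            (AlgHom.id k (DualHopf k H)) (β x))))) = evalDual X ω (α (evalRight X h (β x)))
    induction β x with
    | zero => simp
    | add s t hs ht => simp only [map_add, hs, ht]
    | tmul y θ =>
      simp only [Algebra.TensorProduct.map_tmul, AlgHom.comp_apply, evalRight_tmul, map_smul]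
      induction α y with
      | zero => simp
      | add s t hs ht => simp only [map_add, TensorProduct.add_tmul, smul_add, hs, ht]
      | tmul g z =>
        have : MajidDouble.pairing k H ((MajidDouble.equiv k H).symm (ω ⊗ₜ h))
          ((MajidCodouble.equiv k H).symm (g ⊗ₜ θ)) = pairing k H g ω * pairing k H h θ := rfl
        simp [this, smul_smul, mul_comm]

end Majid

/-! ### The equivalences and the commuting square. -/

section Functors
variable {k : Type u} {H : Type v} [Field k] [Ring H] [HopfAlgebra k H] [FiniteDimensional k H]

/-- Morphisms are determined by their underlying algebra maps, which the functor keeps; fullness is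
perfectness of the pairing. Each object is hit on the nose: its action comes from some `β`, and
`isYDlr_iff` transfers the compatibility. -/
theorem toYDll_isEquivalence
    (h : ∀ X : YDlr.{u, v, w} k H, IsYDll (dualAction X.right) X.left) :
    (toYDll h).IsEquivalence where
  faithful := ⟨fun {X Y} f g e => YDlr.Hom.ext (congrArg YDll.Hom.toAlgHom e)⟩
  full := ⟨fun {X Y} f => ⟨⟨f.toAlgHom, f.comm_coact,
    isBialgebraPairing_pairing.hom_comm_coact f.toAlgHom f.comm_act⟩, rfl⟩⟩
  essSurj := ⟨fun Y => by
    obtain ⟨X, act, δ, hY⟩ := Y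
    obtain ⟨β, rfl⟩ := isBialgebraPairing_pairing.exists_coaction hY.moduleAlgebra
    exact ⟨⟨X, δ, β, (isYDlr_iff δ β).2 hY⟩, ⟨Iso.refl _⟩⟩⟩

theorem toModAlg_isEquivalence (h : ∀ X : ComodAlg.{u, max u v, w} k (MajidCodouble k H),
      IsModuleAlgebra (doubleAction X.coact)) :
    (toModAlg h).IsEquivalence where
  faithful := ⟨fun {X Y} f g e => ComodAlg.Hom.ext (congrArg ModAlg.Hom.toAlgHom e)⟩
  full := ⟨fun {X Y} f => ⟨⟨f.toAlgHom,
    isBialgebraPairing_majidDouble.hom_comm_coact f.toAlgHom f.comm⟩, rfl⟩⟩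
  essSurj := ⟨fun Y => by
    obtain ⟨X, act, hY⟩ := Y
    obtain ⟨γ, rfl⟩ := isBialgebraPairing_majidDouble.exists_coaction hY
    exact ⟨⟨X, γ, (isBialgebraPairing_majidDouble.isRightCoaction_iff γ).2 hY⟩, ⟨Iso.refl _⟩⟩⟩

/-- A map linear over the double is linear over both factors. Linearity over `Ĥ^op` is colinearity
seen through all functionals `ω`, which gives fullness. -/
theorem majidFunctor_isEquivalence
    (h : ∀ X : YDll.{u, v, w} k H, IsModuleAlgebra (majidAction X.act X.coact)) :
    (majidFunctor h).IsEquivalence where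
  faithful := ⟨fun {X Y} f g e => YDll.Hom.ext (congrArg ModAlg.Hom.toAlgHom e)⟩
  full := ⟨fun {X Y} f => ⟨⟨f.toAlgHom,
    fun b x => by
      have := f.comm (MajidDouble.inclRight k H b) x
      exact (congrArg f.toAlgHom (majidAction_inclRight X.isYD b x)).symm.trans
        (this.trans (majidAction_inclRight Y.isYD b _)),
    fun x => by
      refine evalDual_ext fun ω => ?_
      have := f.comm (MajidDouble.inclLeft k H ω) x
      rw [evalDual_lTensor]
      exact (congrArg f.toAlgHom (majidAction_inclLeft X.isYD ω x)).symm.trans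
        (this.trans (majidAction_inclLeft Y.isYD ω _))⟩, rfl⟩⟩
  essSurj := ⟨fun Y => by
    obtain ⟨X, a, hY⟩ := Y
    obtain ⟨act, δ, hX, rfl⟩ := exists_isYDll hY
    exact ⟨⟨X, act, δ, hX⟩, ⟨Iso.refl _⟩⟩⟩

/-- Functors to module algebras that keep the underlying algebra, given by the action. -/
def functorOfAction (a : ∀ X : YDlr.{u, v, w} k H, MajidDouble k H →ₗ[k] X.carrier →ₗ[k] X.carrier)
    (ha : ∀ X, IsModuleAlgebra (a X))
    (hc : ∀ {X Y : YDlr.{u, v, w} k H} (f : X.Hom Y) d x,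
      f.toAlgHom (a X d x) = a Y d (f.toAlgHom x)) :
    YDlr.{u, v, w} k H ⥤ ModAlg.{u, max u v, w} k (MajidDouble k H) where
  obj X := ⟨X.carrier, a X, ha X⟩
  map f := ⟨f.toAlgHom, hc f⟩

/-- The square commutes as an equality of functors because the two actions are equal on every
object. -/
theorem toComodAlg_comp_toModAlg
    (h₁ : ∀ X : YDlr.{u, v, w} k H, IsRightCoaction (codoubleCoaction X.left X.right))
    (h₂ : ∀ X : YDlr.{u, v, w} k H, IsYDll (dualAction X.right) X.left)
    (h₃ : ∀ X : ComodAlg.{u, max u v, w} k (MajidCodouble k H),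
      IsModuleAlgebra (doubleAction X.coact))
    (h₄ : ∀ X : YDll.{u, v, w} k H, IsModuleAlgebra (majidAction X.act X.coact)) :
    toComodAlg h₁ ⋙ toModAlg h₃ = toYDll h₂ ⋙ majidFunctor h₄ := by
  -- Both composites have the shape `functorOfAction`. Substituting the equality of whole families
  -- of actions avoids transporting morphisms along equalities of objects.
  have key : ∀ (a b : ∀ X : YDlr.{u, v, w} k H,
      MajidDouble k H →ₗ[k] X.carrier →ₗ[k] X.carrier) (_ : a = b) ha hc hb hd,
      functorOfAction a ha hc = functorOfAction b hb hd := by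
    rintro a _ rfl _ _ _ _; rfl
  exact key (fun X => doubleAction (codoubleCoaction X.left X.right))
    (fun X => majidAction (dualAction X.right) X.left)
    (funext fun X => doubleAction_codoubleCoaction X.left X.right)
    (fun X => h₃ ⟨X.carrier, _, h₁ X⟩)
    (fun f => ((toComodAlg h₁ ⋙ toModAlg h₃).map f).comm)
    (fun X => h₄ ⟨X.carrier, _, _, h₂ X⟩)
    (fun f => ((toYDll h₂ ⋙ majidFunctor h₄).map f).comm)

end Functors
end
end YetterDrinfeld

theorem mainTheorem8 {k : Type u} {H : Type v} [Field k] [Ring H] [HopfAlgebra k H]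
    [FiniteDimensional k H] :
    ∃ (h₁ : ∀ X : YDlr.{u, v, w} k H, IsRightCoaction (codoubleCoaction X.left X.right))
      (h₂ : ∀ X : YDlr.{u, v, w} k H, IsYDll (dualAction X.right) X.left)
      (h₃ : ∀ X : ComodAlg.{u, max u v, w} k (MajidCodouble k H),
        IsModuleAlgebra (doubleAction X.coact))
      (h₄ : ∀ X : YDll.{u, v, w} k H, IsModuleAlgebra (majidAction X.act X.coact)),
      (toComodAlg h₁).IsEquivalence ∧
      (toYDll h₂).IsEquivalence ∧
      (toModAlg h₃).IsEquivalence ∧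
      (majidFunctor h₄).IsEquivalence ∧
      toComodAlg h₁ ⋙ toModAlg h₃ = toYDll h₂ ⋙ majidFunctor h₄ := by
  have h₂ : ∀ X : YDlr.{u, v, w} k H, IsYDll (dualAction X.right) X.left :=
    fun X => (isYDlr_iff X.left X.right).1 X.isYD
  have h₁ : ∀ X : YDlr.{u, v, w} k H, IsRightCoaction (codoubleCoaction X.left X.right) := by
    intro X
    -- By duality, `γ` is a coaction because the associated action is Majid's, already known to give
    -- a module algebra.
    refine (isBialgebraPairing_majidDouble.isRightCoaction_iff _).2 ?_
    change IsModuleAlgebra (doubleAction (codoubleCoaction X.left X.right))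
    rw [doubleAction_codoubleCoaction]
    exact majidAction_isModuleAlgebra (h₂ X)
  have h₃ : ∀ X : ComodAlg.{u, max u v, w} k (MajidCodouble k H),
      IsModuleAlgebra (doubleAction X.coact) := fun X =>
    (isBialgebraPairing_majidDouble.isRightCoaction_iff X.coact).1 X.isCoaction
  have h₄ : ∀ X : YDll.{u, v, w} k H, IsModuleAlgebra (majidAction X.act X.coact) :=
    fun X => majidAction_isModuleAlgebra X.isYD
  have sq := toComodAlg_comp_toModAlg h₁ h₂ h₃ h₄
  have e₂ := toYDll_isEquivalence h₂
  have e₃ := toModAlg_isEquivalence h₃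
  have e₄ := majidFunctor_isEquivalence h₄
  -- Two out of three: the other composite of the square is an equivalence, and so is the functor
  -- (3).
  have e : (toComodAlg h₁ ⋙ toModAlg h₃).IsEquivalence := by rw [sq]; infer_instance
  exact ⟨h₁, h₂, h₃, h₄, Functor.isEquivalence_of_comp_right _ (toModAlg h₃), e₂, e₃, e₄, sq⟩
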